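/- A single vertex 2-graph is a monoid $\Lambda$ with a degree homomorphism $d:\Lambda\to\mathbb{Z}_+^2$ such that whenever $d(\lambda)=p+q$ there are unique $\mu,\nu$ with $\lambda=\mu\nu$, $d(\mu)=p$, $d(\nu)=q$. Isomorphisms of 2-graphs are degree-preserving monoid isomorphisms. $\Lambda$ has edge multiplicities $(n,m)$ if there are exactly $n$ elements $e_1,\dots,e_n$ of degree $(1,0)$ and $m$ elements $f_1,\dots,f_m$ of degree $(0,1)$. It then has relations $e_if_j=f_{j'}e_{i'}$, $(i',j')=\theta(i,j)$, for a permutation $\theta$ of the $nm$ pairs $(i,j)$, which depends on the labelling of the edges; the relations are of cyclic type if $\theta$ is a single cycle of length $nm$. The norm closed Toeplitz algebra $\mathcal{A}_\Lambda$ is the norm closed algebra of operators on $\ell^2(\Lambda)$ generated by the left shifts $L_w:\xi_v\mapsto\xi_{wv}$, $w\in\Lambda$. Its Gelfand space is the set of points $(\rho(L_{e_1}),\dots,\rho(L_{e_n});\rho(L_{f_1}),\dots,\rho(L_{f_m}))$, where $\rho$ runs over the characters of $\mathcal{A}_\Lambda$; it is of minimal type if it equals $$\big((\mathbb{C}^n\times\{0\})\cup(\{0\}\times\mathbb{C}^m)\cup(E_n\times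 E_m)\big)\cap(\overline{\mathbb{B}}_n\times\overline{\mathbb{B}}_m),$$ where $E_k\subseteq\mathbb{C}^k$ is the set of vectors with all coordinates equal and $\overline{\mathbb{B}}_k$ is the closed Euclidean unit ball. **Theorem 7.5.** Let $\Lambda_1,\Lambda_2$ be single vertex 2-graphs with edge multiplicities $(2,3)$ and relations of cyclic type. Then $\mathcal{A}_{\Lambda_1}$ and $\mathcal{A}_{\Lambda_2}$ are isometrically isomorphic if and only if $\Lambda_1$ and $\Lambda_2$ are isomorphic 2-graphs. A single vertex 2-graph with edge multiplicities $(2,3)$ and relations of cyclic type has Gelfand space of minimal type, and the same equivalence holds for all single vertex 2-graphs $\Lambda_1,\Lambda_2$ with edge multiplicities $(2,3)$ and Gelfand spaces of minimal type. Moreover there are exactly 14 isomorphism classes of single vertex 2-graphs with edge multiplicities $(2,3)$ and relations of cyclic type: the $k$-th class consists of those whose relations are, for some labelling of the edges, given by $\theta_k$, where, numbering the pairs $(1,1),(1,2),(1,3),(2,1),(2,2),(2,3)$ as $1,\dots,6$, $$\begin{gathered}\theta_1=(1\,5\,3\,4\,2\,6),\ \theta_2=(1\,5\,2\,6\,3\,4),\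 \theta_3=(1\,5\,3\,6\,2\,4),\ \theta_4=(1\,2\,3\,6\,5\,4),\ \theta_5=(1\,2\,5\,6\,3\,4),\\ \theta_6=(1\,2\,5\,4\,3\,6),\ \theta_7=(1\,2\,3\,4\,5\,6),\ \theta_8=(1\,2\,3\,4\,6\,5),\ \theta_9=(1\,2\,4\,5\,3\,6),\ \theta_{10}=(1\,2\,3\,5\,6\,4),\\ \theta_{11}=(1\,2\,4\,6\,3\,5),\ \theta_{12}=(1\,2\,4\,6\,5\,3),\ \theta_{13}=(1\,2\,4\,3\,6\,5),\ \theta_{14}=(1\,2\,4\,3\,5\,6).\end{gathered}$$ -/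

import Mathlib

open scoped ENNReal

universe u v

/-- A 2-graph with a single vertex: a category with one object, that is, a monoid of paths `Path`
(composition is multiplication), with a degree functor `d` to `ℕ²` that has the unique
factorisation property.  Countability of `Path` is automatic as soon as the sets of edges,
that is, the paths of degree `(1, 0)` and `(0, 1)`, are finite. -/
structure TwoGraph where
  Path : Type u
  [monoid : Monoid Path]
  d : Path → ℕ × ℕ
  d_one : d 1 = 0
  d_mul : ∀ x y, d (x * y) = d x + d y
  factor : ∀ (x : Path) (p q : ℕ × ℕ), d x = p + q →
    ∃! yz : Path × Path, d yz.1 = p ∧ d yz.2 = q ∧ x = yz.1 * yz.2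

namespace TwoGraph

attribute [instance] TwoGraph.monoid

/-- Isomorphism of 2-graphs: an isomorphism of path categories that preserves the degree. -/
def Iso (Λ₁ : TwoGraph.{u}) (Λ₂ : TwoGraph.{v}) : Prop :=
  ∃ φ : Λ₁.Path ≃* Λ₂.Path, ∀ x, Λ₂.d (φ x) = Λ₁.d x

/-- A labelling of the edges of degree `(1, 0)` as `e 0, …, e (n - 1)` and of the edges of degree
`(0, 1)` as `f 0, …, f (m - 1)`.  It exists iff the edge multiplicities are `(n, m)`. -/
structure Labelling (Λ : TwoGraph.{u}) (n m : ℕ) where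
  e : Fin n ≃ {x : Λ.Path // Λ.d x = (1, 0)}
  f : Fin m ≃ {x : Λ.Path // Λ.d x = (0, 1)}

/-- `Λ` has edge multiplicities `(n, m)` and, for some labelling of its edges, its commutation
relations are `e_i f_j = f_{j'} e_{i'}` where `θ (i, j) = (i', j')`. -/
def HasRelations (Λ : TwoGraph.{u}) {n m : ℕ} (θ : Equiv.Perm (Fin n × Fin m)) : Prop :=
  ∃ l : Λ.Labelling n m, ∀ i j,
    (l.e i : Λ.Path) * (l.f j : Λ.Path) = (l.f (θ (i, j)).2 : Λ.Path) * (l.e (θ (i, j)).1 : Λ.Path)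

/-- `Λ` has edge multiplicities `(n, m)` and its relations are of cyclic type: they are given by a
permutation of the `n m` products that is a single cycle of length `n m`. -/
def IsCyclicType (Λ : TwoGraph.{u}) (n m : ℕ) : Prop :=
  ∃ θ : Equiv.Perm (Fin n × Fin m), θ.IsCycle ∧ θ.support = Finset.univ ∧ Λ.HasRelations θ

/-- The Fock space of `Λ`. -/
abbrev Fock (Λ : TwoGraph.{u}) : Type u := lp (fun _ : Λ.Path => ℂ) 2

/-- The orthonormal basis of the Fock space given by the paths. -/
noncomputable def fockBasis (Λ : TwoGraph.{u}) : HilbertBasis Λ.Path ℂ Λ.Fock :=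
  ⟨LinearIsometryEquiv.refl ℂ _⟩

theorem mul_left_injective_path (Λ : TwoGraph.{u}) (w : Λ.Path) :
    Function.Injective (fun v : Λ.Path => w * v) := by
  intro a b hab
  have hab' : w * a = w * b := hab
  have hd : Λ.d b = Λ.d a := by
    have h := congrArg Λ.d hab'
    rw [Λ.d_mul, Λ.d_mul] at h
    exact (add_left_cancel h).symm
  have h := (Λ.factor (w * a) (Λ.d w) (Λ.d a) (Λ.d_mul w a)).unique
    (y₁ := (w, a)) (y₂ := (w, b)) ⟨rfl, rfl, rfl⟩ ⟨rfl, hd, hab'⟩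
  exact congrArg Prod.snd h

theorem orthonormal_shift (Λ : TwoGraph.{u}) (w : Λ.Path) :
    Orthonormal ℂ (fun v : Λ.Path => Λ.fockBasis (w * v)) :=
  Λ.fockBasis.orthonormal.comp _ (Λ.mul_left_injective_path w)

/-- The left shift `L_w`, the isometry of the Fock space that maps `ξ_v` to `ξ_{wv}`. -/
noncomputable def shift (Λ : TwoGraph.{u}) (w : Λ.Path) : Λ.Fock →L[ℂ] Λ.Fock :=
  (Λ.orthonormal_shift w).orthogonalFamily.linearIsometry.toContinuousLinearMap

theorem shift_apply_basis (Λ : TwoGraph.{u}) (w v : Λ.Path) :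
    Λ.shift w (Λ.fockBasis v) = Λ.fockBasis (w * v) := by
  classical
  have h : Λ.fockBasis v = lp.single 2 v (1 : ℂ) := by
    rw [← Λ.fockBasis.repr_symm_single v]; rfl
  rw [h]
  simp [shift]

/-- The norm closed Toeplitz algebra of `Λ`, generated by the left shifts. -/
noncomputable def toeplitz (Λ : TwoGraph.{u}) : Subalgebra ℂ (Λ.Fock →L[ℂ] Λ.Fock) :=
  (Algebra.adjoin ℂ (Set.range Λ.shift)).topologicalClosure

/-- The left shift `L_w` as an element of the norm closed Toeplitz algebra. -/
noncomputable def toeplitzShift (Λ : TwoGraph.{u}) (w : Λ.Path) : Λ.toeplitz :=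
  ⟨Λ.shift w, Subalgebra.le_topologicalClosure _ (Algebra.subset_adjoin ⟨w, rfl⟩)⟩

/-- The norm closed Toeplitz algebras of `Λ₁` and `Λ₂` are isometrically isomorphic. -/
def ToeplitzIsometric (Λ₁ : TwoGraph.{u}) (Λ₂ : TwoGraph.{v}) : Prop :=
  ∃ φ : Λ₁.toeplitz ≃ₐ[ℂ] Λ₂.toeplitz, Isometry φ

/-- The minimal Gelfand space in `ℂⁿ × ℂᵐ`: the part in the product of the closed unit balls of
`(ℂⁿ × 0) ∪ (0 × ℂᵐ) ∪ (E_n × E_m)`, where `E_n` consists of the constant vectors. -/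
def minimalGelfand (n m : ℕ) : Set (EuclideanSpace ℂ (Fin n) × EuclideanSpace ℂ (Fin m)) :=
  {p | ‖p.1‖ ≤ 1 ∧ ‖p.2‖ ≤ 1 ∧
    (p.2 = 0 ∨ p.1 = 0 ∨ ((∀ i i', p.1 i = p.1 i') ∧ ∀ j j', p.2 j = p.2 j'))}

/-- The coordinates `(ρ(L_{e_1}), …, ρ(L_{e_n}); ρ(L_{f_1}), …, ρ(L_{f_m}))` of a character `ρ`
of the norm closed Toeplitz algebra. -/
noncomputable def gelfandCoord (Λ : TwoGraph.{u}) {n m : ℕ} (l : Λ.Labelling n m)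
    (ρ : WeakDual.characterSpace ℂ Λ.toeplitz) :
    EuclideanSpace ℂ (Fin n) × EuclideanSpace ℂ (Fin m) :=
  (WithLp.toLp 2 fun i => ρ (Λ.toeplitzShift (l.e i)),
    WithLp.toLp 2 fun j => ρ (Λ.toeplitzShift (l.f j)))

/-- `Λ` has edge multiplicities `(n, m)` and the Gelfand space of its norm closed Toeplitz algebra,
identified with a subset of `ℂⁿ × ℂᵐ` through the values of the characters at the generators,
is of minimal type. -/
def HasMinimalGelfandSpace (Λ : TwoGraph.{u}) (n m : ℕ) : Prop :=
  ∃ l : Λ.Labelling n m, Set.range (Λ.gelfandCoord l) = minimalGelfand n m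

/-- Single vertex 2-graphs with edge multiplicities `(n, m)` and relations of cyclic type. -/
def CyclicTwoGraph (n m : ℕ) : Type (u + 1) := {Λ : TwoGraph.{u} // Λ.IsCyclicType n m}

/-- Isomorphism as an equivalence relation; its quotient is the set of isomorphism classes. -/
instance cyclicSetoid (n m : ℕ) : Setoid (CyclicTwoGraph.{u} n m) where
  r Λ₁ Λ₂ := Iso Λ₁.1 Λ₂.1
  iseqv :=
    { refl := fun _ => ⟨MulEquiv.refl _, fun _ => rfl⟩
      symm := fun ⟨φ, h⟩ => ⟨φ.symm, fun x => by rw [← h, MulEquiv.apply_symm_apply]⟩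
      trans := fun ⟨φ, h⟩ ⟨ψ, k⟩ => ⟨φ.trans ψ, fun x => (k (φ x)).trans (h x)⟩ }

/-- The cells of the `2 × 3` rectangle, numbered `1, 2, 3` in the first row and `4, 5, 6` in the
second row. -/
def cell (c : ℕ) : Fin 2 × Fin 3 := (Fin.ofNat 2 ((c - 1) / 3), Fin.ofNat 3 ((c - 1) % 3))

/-- The cyclic permutation `c₁ ↦ c₂ ↦ ⋯ ↦ c₁` of the cells with the given numbers. -/
def cellCycle (l : List ℕ) : Equiv.Perm (Fin 2 × Fin 3) := (l.map cell).formPerm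

/-- The fourteen representative permutations `θ_1, …, θ_14` (here indexed from `0`). -/
def theta : Fin 14 → Equiv.Perm (Fin 2 × Fin 3) :=
  ![cellCycle [1, 5, 3, 4, 2, 6], cellCycle [1, 5, 2, 6, 3, 4], cellCycle [1, 5, 3, 6, 2, 4],
    cellCycle [1, 2, 3, 6, 5, 4], cellCycle [1, 2, 5, 6, 3, 4], cellCycle [1, 2, 5, 4, 3, 6],
    cellCycle [1, 2, 3, 4, 5, 6], cellCycle [1, 2, 3, 4, 6, 5], cellCycle [1, 2, 4, 5, 3, 6],
    cellCycle [1, 2, 3, 5, 6, 4], cellCycle [1, 2, 4, 6, 3, 5], cellCycle [1, 2, 4, 6, 5, 3],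
    cellCycle [1, 2, 4, 3, 6, 5], cellCycle [1, 2, 4, 3, 5, 6]]

end TwoGraph

/-!
The three analytic statements rest on one computation with coefficients. An element `a` of the
Toeplitz algebra has coefficients `a_x = ⟪ξ_x, a ξ_1⟫` (`coeff`), and the coefficients of a product
are given by the factorisations of `x` (`coeff_mul`). In particular `a ↦ a_1` is a character, and
the coefficients at the edges are point derivations at it.

*Gelfand space.* If the relations are `e_i f_j = f_{j'} e_{i'}` with `(i', j') = θ (i, j)`, the
Gelfand space is the part of the cone `z_i w_j = z_{i'} w_{j'}` (`relVariety θ`) in the product of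
the closed balls (`range_gelfandCoord`): an interior point of the cone is a square summable
multiplicative function on the paths, hence a vector functional that is multiplicative, and the
boundary is reached by compactness. For a single cycle all products `z_i w_j` are equal, so the
cone is the minimal one.

*Rigidity.* Let `φ` be an isometric isomorphism between the algebras of two 2-graphs whose cones
are minimal. At every character other than `a ↦ a_1` the values of a point derivation at the edges
satisfy a nontrivial linear relation, as otherwise the cone would be larger; so `φ` preserves
`a ↦ a_1` (`coeff_one_apply_edge`). Its linear part `T` there is an invertible matrix
(`linearPart_symm_mul`), and the coefficients of degree two show that `T` maps the cone of the
second 2-graph into that of the first (`linearPart_mulVec_mem`). Since `2 ≤ n < m`, this forces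
`T = A ⊕ B`, where `A` and `B` map constant vectors to constant vectors
(`blockDiagonal_of_minimalCone`); they are unitary because `φ` is isometric, and hence commute with
the matrices of ones. The coefficients of degree `(1, 1)` show that `A ⊗ B` intertwines the
permutation matrices `P` of the two 2-graphs. It therefore preserves the trace of every word in `P`,
`Pᵀ` and the 0-1 matrices of the relations "same column" and "same row"
(`traceInvariants_eq_of_intertwining`). For the `2 × 3` rectangle seven such traces distinguish all
84 classes of permutations up to relabelling of rows and columns (`nodup_traceInvariants`), so the
relations agree after relabelling the edges, and the 2-graphs are isomorphic.

*Classification.* Every permutation `θ` gives a 2-graph whose paths are the normal forms `e_v f_u`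
(`ofPerm`), and every 2-graph with the relations `θ` is isomorphic to it (`HasRelations.iso`). Two
of them are isomorphic iff the permutations agree up to relabelling (`HasRelations.prodConj`), and
the classes of cyclic permutations are enumerated by a finite computation.
-/

namespace TwoGraph

/-! ### Factorisation and relabelling -/

section Factorisation

variable {Λ : TwoGraph.{u}}

theorem eq_and_eq_of_mul_eq_mul {x y x' y' : Λ.Path} (h : x * y = x' * y')
    (hd : Λ.d x = Λ.d x') : x = x' ∧ y = y' := by
  have hy : Λ.d y' = Λ.d y := by
    have h' := congrArg Λ.d h
    rw [Λ.d_mul, Λ.d_mul, hd] at h'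
    exact (add_left_cancel h').symm
  have h' := (Λ.factor (x * y) (Λ.d x) (Λ.d y) (Λ.d_mul x y)).unique
    (y₁ := (x, y)) (y₂ := (x', y')) ⟨rfl, rfl, rfl⟩ ⟨hd.symm, hy, h⟩
  exact ⟨congrArg Prod.fst h', congrArg Prod.snd h'⟩

theorem exists_eq_mul (x : Λ.Path) {p q : ℕ × ℕ} (h : Λ.d x = p + q) :
    ∃ y z, Λ.d y = p ∧ Λ.d z = q ∧ x = y * z := by
  obtain ⟨⟨y, z⟩, hyz, -⟩ := Λ.factor x p q h
  exact ⟨y, z, hyz⟩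

theorem eq_one_of_d_eq_zero {x : Λ.Path} (h : Λ.d x = 0) : x = 1 :=
  (eq_and_eq_of_mul_eq_mul (x := x) (y := 1) (x' := 1) (y' := x) (by simp)
    (h.trans Λ.d_one.symm)).1

end Factorisation

namespace Labelling

variable {Λ : TwoGraph.{u}} {n m : ℕ} (l : Λ.Labelling n m)

theorem d_e (i : Fin n) : Λ.d (l.e i) = (1, 0) := (l.e i).2

theorem d_f (j : Fin m) : Λ.d (l.f j) = (0, 1) := (l.f j).2

theorem exists_e {x : Λ.Path} (h : Λ.d x = (1, 0)) : ∃ i, (l.e i : Λ.Path) = x :=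
  ⟨l.e.symm ⟨x, h⟩, by simp⟩

theorem exists_f {x : Λ.Path} (h : Λ.d x = (0, 1)) : ∃ j, (l.f j : Λ.Path) = x :=
  ⟨l.f.symm ⟨x, h⟩, by simp⟩

theorem e_inj {i i' : Fin n} : (l.e i : Λ.Path) = l.e i' ↔ i = i' := by
  rw [Subtype.coe_inj, l.e.apply_eq_iff_eq]

theorem f_inj {j j' : Fin m} : (l.f j : Λ.Path) = l.f j' ↔ j = j' := by
  rw [Subtype.coe_inj, l.f.apply_eq_iff_eq]

/-- Every path is reached from the vertex by composing edges on the left. -/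
theorem path_induction {P : Λ.Path → Prop} (one : P 1)
    (e_mul : ∀ i x, P x → P (l.e i * x)) (f_mul : ∀ j x, P x → P (l.f j * x)) (x : Λ.Path) :
    P x := by
  have key : ∀ (k : ℕ) (x : Λ.Path), (Λ.d x).1 + (Λ.d x).2 = k → P x := by
    intro k
    induction k with
    | zero =>
      intro x hx
      rw [eq_one_of_d_eq_zero (x := x) (Prod.ext (by simp; omega) (by simp; omega))]
      exact one
    | succ k ih =>
      intro x hx
      rcases Nat.eq_zero_or_pos (Λ.d x).1 with h0 | h0
      · obtain ⟨y, z, hy, hz, rfl⟩ := exists_eq_mul x (p := (0, 1))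
          (q := ((Λ.d x).1, (Λ.d x).2 - 1)) (Prod.ext (by simp) (by simp; omega))
        obtain ⟨j, rfl⟩ := l.exists_f hy
        refine f_mul j z (ih z ?_)
        rw [Λ.d_mul, l.d_f] at hx
        simp at hx
        omega
      · obtain ⟨y, z, hy, hz, rfl⟩ := exists_eq_mul x (p := (1, 0))
          (q := ((Λ.d x).1 - 1, (Λ.d x).2)) (Prod.ext (by simp; omega) (by simp))
        obtain ⟨i, rfl⟩ := l.exists_e hy
        refine e_mul i z (ih z ?_)
        rw [Λ.d_mul, l.d_e] at hx
        simp at hx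
        omega
  exact key _ x rfl

/-- The commutation relations of the edges, in the given labelling, are
`e_i f_j = f_{j'} e_{i'}` with `(i', j') = θ (i, j)`. -/
def Relations (θ : Equiv.Perm (Fin n × Fin m)) : Prop :=
  ∀ i j, (l.e i : Λ.Path) * (l.f j : Λ.Path) =
    (l.f (θ (i, j)).2 : Λ.Path) * (l.e (θ (i, j)).1 : Λ.Path)

theorem exists_relations : ∃ θ, l.Relations θ := by
  have h : ∀ c : Fin n × Fin m, ∃ c' : Fin n × Fin m,
      (l.e c.1 : Λ.Path) * (l.f c.2 : Λ.Path) = (l.f c'.2 : Λ.Path) * (l.e c'.1 : Λ.Path) := by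
    intro c
    obtain ⟨y, z, hy, hz, hyz⟩ := exists_eq_mul ((l.e c.1 : Λ.Path) * (l.f c.2 : Λ.Path))
      (p := (0, 1)) (q := (1, 0)) (by rw [Λ.d_mul, l.d_e, l.d_f]; rfl)
    obtain ⟨j, rfl⟩ := l.exists_f hy
    obtain ⟨i, rfl⟩ := l.exists_e hz
    exact ⟨(i, j), hyz⟩
  choose g hg using h
  have hinj : Function.Injective g := by
    intro c c' hcc
    have h1 := (hg c).trans ((congrArg (fun c => (l.f c.2 : Λ.Path) * (l.e c.1 : Λ.Path))
      hcc).trans (hg c').symm)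
    obtain ⟨h2, h3⟩ := eq_and_eq_of_mul_eq_mul h1 (by rw [l.d_e, l.d_e])
    exact Prod.ext (l.e_inj.1 h2) (l.f_inj.1 h3)
  exact ⟨Equiv.ofBijective g (Finite.injective_iff_bijective.1 hinj), fun i j => hg (i, j)⟩

variable {l}

theorem Relations.unique {θ θ' : Equiv.Perm (Fin n × Fin m)} (h : l.Relations θ)
    (h' : l.Relations θ') : θ = θ' := by
  ext1 ⟨i, j⟩
  obtain ⟨h2, h3⟩ := eq_and_eq_of_mul_eq_mul ((h i j).symm.trans (h' i j))
    (by rw [l.d_f, l.d_f])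
  exact Prod.ext (l.e_inj.1 h3) (l.f_inj.1 h2)

end Labelling

/-- Product conjugacy: `θ` and `θ'` are conjugate by a permutation of the pairs that comes from
relabelling rows and columns separately. -/
def ProdConj {n m : ℕ} (θ θ' : Equiv.Perm (Fin n × Fin m)) : Prop :=
  ∃ (s : Equiv.Perm (Fin n)) (t : Equiv.Perm (Fin m)),
    ∀ c, θ' (Prod.map s t c) = Prod.map s t (θ c)

theorem ProdConj.symm {n m : ℕ} {θ θ' : Equiv.Perm (Fin n × Fin m)} (h : ProdConj θ θ') :
    ProdConj θ' θ := by
  obtain ⟨s, t, h⟩ := h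
  refine ⟨s.symm, t.symm, fun c => ?_⟩
  have hc := h (Prod.map s.symm t.symm c)
  have h1 : ∀ c, Prod.map s t (Prod.map s.symm t.symm c) = c := fun c => by
    simp [Prod.map]
  rw [h1] at hc
  rw [hc]
  simp [Prod.map]

theorem ProdConj.trans {n m : ℕ} {θ θ' θ'' : Equiv.Perm (Fin n × Fin m)} (h : ProdConj θ θ')
    (h' : ProdConj θ' θ'') : ProdConj θ θ'' := by
  obtain ⟨s, t, h⟩ := h
  obtain ⟨s', t', h'⟩ := h'
  refine ⟨s.trans s', t.trans t', fun c => ?_⟩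
  have := h' (Prod.map s t c)
  rw [h c] at this
  exact this

section HasRelations

variable {Λ : TwoGraph.{u}} {n m : ℕ} {θ θ' : Equiv.Perm (Fin n × Fin m)}

theorem HasRelations.of_prodConj (h : Λ.HasRelations θ) (hc : ProdConj θ θ') :
    Λ.HasRelations θ' := by
  obtain ⟨l, hl⟩ := h
  obtain ⟨s, t, hst⟩ := hc.symm
  refine ⟨⟨s.trans l.e, t.trans l.f⟩, fun i j => ?_⟩
  have h1 := hl (s i) (t j)
  have h2 := hst (i, j)
  simp only [Prod.map] at h2
  rw [h2] at h1
  exact h1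

/-- The permutation of a 2-graph is determined up to product conjugacy. -/
theorem HasRelations.prodConj (h : Λ.HasRelations θ) (h' : Λ.HasRelations θ') :
    ProdConj θ θ' := by
  obtain ⟨l, hl⟩ := h
  obtain ⟨l', hl'⟩ := h'
  refine ⟨l.e.trans l'.e.symm, l.f.trans l'.f.symm, fun ⟨i, j⟩ => ?_⟩
  have h1 := hl' (l'.e.symm (l.e i)) (l'.f.symm (l.f j))
  rw [Equiv.apply_symm_apply, Equiv.apply_symm_apply, hl i j] at h1
  obtain ⟨h2, h3⟩ := eq_and_eq_of_mul_eq_mul h1 (by rw [l.d_f, l'.d_f])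
  rw [Subtype.coe_inj] at h2 h3
  exact Prod.ext (by simp [h3]) (by simp [h2])

theorem HasRelations.of_iso {Λ' : TwoGraph.{v}} (h : Λ.HasRelations θ) (hi : Iso Λ Λ') :
    Λ'.HasRelations θ := by
  obtain ⟨l, hl⟩ := h
  obtain ⟨φ, hφ⟩ := hi
  refine ⟨⟨l.e.trans (φ.toEquiv.subtypeEquiv fun x => by simp [hφ]),
    l.f.trans (φ.toEquiv.subtypeEquiv fun x => by simp [hφ])⟩, fun i j => ?_⟩
  simpa using congrArg φ (hl i j)

end HasRelations

/-! ### The 2-graph of a permutation -/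

section Commute

variable {n m : ℕ} (θ : Equiv.Perm (Fin n × Fin m))

/-- Moves `f_j` to the right past the word `e_v`: `f_j e_v = e_{v'} f_{j'}` where
`(v', j') = passOne θ j v`. -/
def passOne : Fin m → List (Fin n) → List (Fin n) × Fin m
  | j, [] => ([], j)
  | j, i :: v =>
    ((θ.symm (i, j)).1 :: (passOne (θ.symm (i, j)).2 v).1, (passOne (θ.symm (i, j)).2 v).2)

/-- Moves the word `f_u` to the right past the word `e_v`: `f_u e_v = e_{v'} f_{u'}` where
`(v', u') = pass θ u v`. -/
def pass : List (Fin m) → List (Fin n) → List (Fin n) × List (Fin m)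
  | [], v => (v, [])
  | j :: u, v => ((passOne θ j (pass u v).1).1, (passOne θ j (pass u v).1).2 :: (pass u v).2)

theorem length_passOne (j : Fin m) (v : List (Fin n)) :
    (passOne θ j v).1.length = v.length := by
  induction v generalizing j with
  | nil => rfl
  | cons i v ih => simp [passOne, ih]

theorem length_pass_fst (u : List (Fin m)) (v : List (Fin n)) :
    (pass θ u v).1.length = v.length := by
  induction u with
  | nil => rfl
  | cons j u ih => simp [pass, length_passOne, ih]

theorem length_pass_snd (u : List (Fin m)) (v : List (Fin n)) :
    (pass θ u v).2.length = u.length := by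
  induction u with
  | nil => rfl
  | cons j u ih => simp [pass, ih]

theorem pass_nil (u : List (Fin m)) : pass θ u [] = ([], u) := by
  induction u with
  | nil => rfl
  | cons j u ih => simp [pass, ih, passOne]

theorem passOne_append (j : Fin m) (v v' : List (Fin n)) :
    passOne θ j (v ++ v') = ((passOne θ j v).1 ++ (passOne θ (passOne θ j v).2 v').1,
      (passOne θ (passOne θ j v).2 v').2) := by
  induction v generalizing j with
  | nil => rfl
  | cons i v ih => simp [passOne, ih]

theorem pass_append_right (u : List (Fin m)) (v v' : List (Fin n)) :
    pass θ u (v ++ v') = ((pass θ u v).1 ++ (pass θ (pass θ u v).2 v').1,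
      (pass θ (pass θ u v).2 v').2) := by
  induction u with
  | nil => rfl
  | cons j u ih => simp [pass, ih, passOne_append]

theorem pass_append_left (u u' : List (Fin m)) (v : List (Fin n)) :
    pass θ (u ++ u') v = ((pass θ u (pass θ u' v).1).1,
      (pass θ u (pass θ u' v).1).2 ++ (pass θ u' v).2) := by
  induction u with
  | nil => rfl
  | cons j u ih => simp [pass, ih]

theorem passOne_inj {j j' : Fin m} {v v' : List (Fin n)}
    (h : passOne θ j v = passOne θ j' v') : j = j' ∧ v = v' := by
  induction v generalizing j j' v' with
  | nil =>
    cases v' with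
    | nil => exact ⟨congrArg Prod.snd h, rfl⟩
    | cons i v' => simp [passOne] at h
  | cons i v ih =>
    cases v' with
    | nil => simp [passOne] at h
    | cons i' v' =>
      simp only [passOne, Prod.mk.injEq, List.cons.injEq] at h
      obtain ⟨⟨h1, h2⟩, h3⟩ := h
      obtain ⟨h4, rfl⟩ := ih (Prod.ext h2 h3)
      have h5 := θ.symm.injective (Prod.ext h1 h4)
      simp only [Prod.mk.injEq] at h5
      exact ⟨h5.2, by rw [h5.1]⟩

theorem pass_inj {u u' : List (Fin m)} {v v' : List (Fin n)}
    (h : pass θ u v = pass θ u' v') : u = u' ∧ v = v' := by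
  induction u generalizing u' v' with
  | nil =>
    cases u' with
    | nil => exact ⟨rfl, congrArg Prod.fst h⟩
    | cons j u' => simp [pass] at h
  | cons j u ih =>
    cases u' with
    | nil => simp [pass] at h
    | cons j' u' =>
      simp only [pass, Prod.mk.injEq, List.cons.injEq] at h
      obtain ⟨h1, h2, h3⟩ := h
      obtain ⟨rfl, h4⟩ := passOne_inj θ (Prod.ext h1 h2)
      obtain ⟨rfl, rfl⟩ := ih (Prod.ext h4 h3)
      exact ⟨rfl, rfl⟩

theorem exists_passOne (v : List (Fin n)) (j : Fin m) : ∃ j' v', passOne θ j' v' = (v, j) := by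
  induction v with
  | nil => exact ⟨j, [], rfl⟩
  | cons i v ih =>
    obtain ⟨j', v', h⟩ := ih
    exact ⟨(θ (i, j')).2, (θ (i, j')).1 :: v', by simp [passOne, h]⟩

theorem exists_pass (v : List (Fin n)) (u : List (Fin m)) : ∃ u' v', pass θ u' v' = (v, u) := by
  induction u generalizing v with
  | nil => exact ⟨[], v, rfl⟩
  | cons j u ih =>
    obtain ⟨j', w, h⟩ := exists_passOne θ v j
    obtain ⟨u', v', h'⟩ := ih w
    exact ⟨j' :: u', v', by simp [pass, h, h']⟩

end Commute

/-- A word `e_v f_u` in normal form, for the relations given by `θ`; the letters of both words are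
indices of edges.  The type is placed in an arbitrary universe, as `TwoGraph` requires. -/
@[ext]
structure NormalForm {n m : ℕ} (θ : Equiv.Perm (Fin n × Fin m)) : Type u where
  e : List (Fin n)
  f : List (Fin m)

namespace NormalForm

variable {n m : ℕ} {θ : Equiv.Perm (Fin n × Fin m)}

instance : Monoid (NormalForm.{u} θ) where
  mul x y := ⟨x.e ++ (pass θ x.f y.e).1, (pass θ x.f y.e).2 ++ y.f⟩
  one := ⟨[], []⟩
  mul_assoc x y z := by
    change NormalForm.mk _ _ = NormalForm.mk _ _
    dsimp only [HMul.hMul]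
    simp [pass_append_left, pass_append_right]
  one_mul x := rfl
  mul_one x := by
    change NormalForm.mk _ _ = _
    change NormalForm.mk (x.e ++ (pass θ x.f []).1) ((pass θ x.f []).2 ++ []) = x
    simp [pass_nil]

theorem mul_def (x y : NormalForm.{u} θ) :
    x * y = ⟨x.e ++ (pass θ x.f y.e).1, (pass θ x.f y.e).2 ++ y.f⟩ := rfl

theorem one_def : (1 : NormalForm.{u} θ) = ⟨[], []⟩ := rfl

end NormalForm

/-- The single vertex 2-graph with the relations `e_i f_j = f_{j'} e_{i'}`,
`(i', j') = θ (i, j)`: its paths are the words in normal form. -/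
def ofPerm {n m : ℕ} (θ : Equiv.Perm (Fin n × Fin m)) : TwoGraph.{u} where
  Path := NormalForm.{u} θ
  d x := (x.e.length, x.f.length)
  d_one := rfl
  d_mul x y := by
    simp [NormalForm.mul_def, length_pass_fst, length_pass_snd]
  factor x p q h := by
    have h1 : x.e.length = p.1 + q.1 := congrArg Prod.fst h
    have h2 : x.f.length = p.2 + q.2 := congrArg Prod.snd h
    obtain ⟨u, v, huv⟩ := exists_pass θ (x.e.drop p.1) (x.f.take p.2)
    have hu := length_pass_snd θ u v
    have hv := length_pass_fst θ u v
    rw [huv] at hu hv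
    simp only [List.length_take, List.length_drop] at hu hv
    refine ⟨(⟨x.e.take p.1, u⟩, ⟨v, x.f.drop p.2⟩), ⟨?_, ?_, ?_⟩, ?_⟩
    · exact Prod.ext (by simp; omega) (by simp; omega)
    · exact Prod.ext (by simp; omega) (by simp; omega)
    · ext1 <;> simp [NormalForm.mul_def, huv]
    · rintro ⟨y, z⟩ ⟨hy, hz, rfl⟩
      have hy1 : y.e.length = p.1 := congrArg Prod.fst hy
      have hy2 : y.f.length = p.2 := congrArg Prod.snd hy
      have h3 : (pass θ y.f z.e).2.length = p.2 := by rw [length_pass_snd, hy2]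
      simp only [NormalForm.mul_def] at huv
      rw [List.drop_left' hy1, List.take_left' h3] at huv
      obtain ⟨rfl, rfl⟩ := pass_inj θ huv
      refine Prod.ext (NormalForm.ext ?_ rfl) (NormalForm.ext rfl ?_)
      · simp [NormalForm.mul_def, List.take_left' hy1]
      · simp [NormalForm.mul_def, List.drop_left' h3]

/-- The edges of `ofPerm θ`, labelled by the letters. -/
noncomputable def ofPermLabelling {n m : ℕ} (θ : Equiv.Perm (Fin n × Fin m)) :
    (ofPerm.{u} θ).Labelling n m where
  e := Equiv.ofBijective (fun i => ⟨NormalForm.mk [i] [], rfl⟩) <| by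
    constructor
    · intro i i' h
      simpa using congrArg (fun x => NormalForm.e x.1) h
    · rintro ⟨x, hx⟩
      obtain ⟨i, hi⟩ := List.length_eq_one_iff.1 (congrArg Prod.fst hx : x.e.length = 1)
      refine ⟨i, Subtype.ext (NormalForm.ext hi.symm ?_)⟩
      exact (List.eq_nil_of_length_eq_zero (congrArg Prod.snd hx : x.f.length = 0)).symm
  f := Equiv.ofBijective (fun j => ⟨NormalForm.mk [] [j], rfl⟩) <| by
    constructor
    · intro i i' h
      simpa using congrArg (fun x => NormalForm.f x.1) h
    · rintro ⟨x, hx⟩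
      obtain ⟨i, hi⟩ := List.length_eq_one_iff.1 (congrArg Prod.snd hx : x.f.length = 1)
      refine ⟨i, Subtype.ext (NormalForm.ext ?_ hi.symm)⟩
      exact (List.eq_nil_of_length_eq_zero (congrArg Prod.fst hx : x.e.length = 0)).symm

theorem ofPerm_hasRelations {n m : ℕ} (θ : Equiv.Perm (Fin n × Fin m)) :
    (ofPerm.{u} θ).HasRelations θ := by
  refine ⟨ofPermLabelling θ, fun i j => ?_⟩
  have h : (NormalForm.mk [i] [] * NormalForm.mk [] [j] : NormalForm.{u} θ) =
      NormalForm.mk [] [(θ (i, j)).2] * NormalForm.mk [(θ (i, j)).1] [] := by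
    simp [NormalForm.mul_def, pass, passOne]
  exact h

namespace Labelling

variable {Λ : TwoGraph.{u}} {n m : ℕ} (l : Λ.Labelling n m)

/-- The path `e_v`. -/
def ePath (v : List (Fin n)) : Λ.Path := (v.map fun i => (l.e i : Λ.Path)).prod

/-- The path `f_u`. -/
def fPath (u : List (Fin m)) : Λ.Path := (u.map fun j => (l.f j : Λ.Path)).prod

theorem d_ePath (v : List (Fin n)) : Λ.d (l.ePath v) = (v.length, 0) := by
  induction v with
  | nil => exact Λ.d_one
  | cons i v ih =>
    simp only [ePath, List.map_cons, List.prod_cons, Λ.d_mul, l.d_e] at ih ⊢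
    rw [ih]
    simp [add_comm]

theorem d_fPath (u : List (Fin m)) : Λ.d (l.fPath u) = (0, u.length) := by
  induction u with
  | nil => exact Λ.d_one
  | cons i v ih =>
    simp only [fPath, List.map_cons, List.prod_cons, Λ.d_mul, l.d_f] at ih ⊢
    rw [ih]
    simp [add_comm]

theorem ePath_injective : Function.Injective l.ePath := by
  intro v
  induction v with
  | nil =>
    intro v' h
    have := congrArg Λ.d h
    rw [l.d_ePath, l.d_ePath] at this
    exact (List.eq_nil_of_length_eq_zero (congrArg Prod.fst this).symm).symm
  | cons i v ih =>
    intro v' h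
    cases v' with
    | nil =>
      have := congrArg Λ.d h
      rw [l.d_ePath, l.d_ePath] at this
      simp at this
    | cons i' v' =>
      simp only [ePath, List.map_cons, List.prod_cons] at h ih
      obtain ⟨h1, h2⟩ := eq_and_eq_of_mul_eq_mul h (by rw [l.d_e, l.d_e])
      rw [l.e_inj.1 h1, ih h2]

theorem fPath_injective : Function.Injective l.fPath := by
  intro v
  induction v with
  | nil =>
    intro v' h
    have := congrArg Λ.d h
    rw [l.d_fPath, l.d_fPath] at this
    exact (List.eq_nil_of_length_eq_zero (congrArg Prod.snd this).symm).symm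
  | cons i v ih =>
    intro v' h
    cases v' with
    | nil =>
      have := congrArg Λ.d h
      rw [l.d_fPath, l.d_fPath] at this
      simp at this
    | cons i' v' =>
      simp only [fPath, List.map_cons, List.prod_cons] at h ih
      obtain ⟨h1, h2⟩ := eq_and_eq_of_mul_eq_mul h (by rw [l.d_f, l.d_f])
      rw [l.f_inj.1 h1, ih h2]

variable {l} {θ : Equiv.Perm (Fin n × Fin m)}

theorem Relations.f_mul_e (h : l.Relations θ) (i : Fin n) (j : Fin m) :
    (l.f j : Λ.Path) * (l.e i : Λ.Path) =
      (l.e (θ.symm (i, j)).1 : Λ.Path) * (l.f (θ.symm (i, j)).2 : Λ.Path) := by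
  rw [h]
  simp

theorem Relations.f_mul_ePath (h : l.Relations θ) (j : Fin m) (v : List (Fin n)) :
    (l.f j : Λ.Path) * l.ePath v = l.ePath (passOne θ j v).1 * l.f (passOne θ j v).2 := by
  induction v generalizing j with
  | nil => simp [ePath, passOne]
  | cons i v ih =>
    have h1 : ∀ i v, l.ePath (i :: v) = l.e i * l.ePath v := fun i v => by simp [ePath]
    rw [h1, ← mul_assoc, h.f_mul_e, mul_assoc, ih, ← mul_assoc, ← h1]
    rfl

theorem Relations.fPath_mul_ePath (h : l.Relations θ) (u : List (Fin m)) (v : List (Fin n)) :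
    l.fPath u * l.ePath v = l.ePath (pass θ u v).1 * l.fPath (pass θ u v).2 := by
  induction u with
  | nil => simp [fPath, pass]
  | cons j u ih =>
    have h1 : ∀ j u, l.fPath (j :: u) = l.f j * l.fPath u := fun j u => by simp [fPath]
    rw [h1, mul_assoc, ih, ← mul_assoc, h.f_mul_ePath, mul_assoc, ← h1]
    rfl

/-- A 2-graph is determined by its relations: every path has a unique normal form `e_v f_u`, and
normal forms are multiplied by means of the relations alone. -/
theorem Relations.exists_equiv (h : l.Relations θ) : ∃ φ : (ofPerm.{v} θ).Path ≃* Λ.Path,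
    (∀ x : NormalForm θ, φ x = l.ePath x.e * l.fPath x.f) ∧
      ∀ x, Λ.d (φ x) = (ofPerm.{v} θ).d x := by
  have hd : ∀ x : NormalForm.{v} θ,
      Λ.d (l.ePath x.e * l.fPath x.f) = (x.e.length, x.f.length) := fun x => by
    rw [Λ.d_mul, l.d_ePath, l.d_fPath]
    simp
  let φ : NormalForm.{v} θ →* Λ.Path :=
    { toFun := fun x => l.ePath x.e * l.fPath x.f
      map_one' := by simp [NormalForm.one_def, ePath, fPath]
      map_mul' := fun x y => by
        have h1 : l.ePath x.e * l.fPath x.f * (l.ePath y.e * l.fPath y.f) =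
            l.ePath x.e * (l.fPath x.f * l.ePath y.e) * l.fPath y.f := by
          simp only [mul_assoc]
        rw [h1, h.fPath_mul_ePath]
        simp [NormalForm.mul_def, ePath, fPath, mul_assoc] }
  have hb : Function.Bijective φ := by
    constructor
    · intro x y hxy
      have hxy' : l.ePath x.e * l.fPath x.f = l.ePath y.e * l.fPath y.f := hxy
      have h1 := congrArg Λ.d hxy'
      rw [hd, hd] at h1
      obtain ⟨h2, h3⟩ := eq_and_eq_of_mul_eq_mul hxy'
        (by rw [l.d_ePath, l.d_ePath]; simpa using congrArg Prod.fst h1)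
      exact NormalForm.ext (l.ePath_injective h2) (l.fPath_injective h3)
    · intro x
      induction x using l.path_induction with
      | one => exact ⟨1, map_one φ⟩
      | e_mul i x ih =>
        obtain ⟨y, rfl⟩ := ih
        exact ⟨⟨[i], []⟩ * y, by rw [map_mul]; simp [φ, ePath, fPath]⟩
      | f_mul j x ih =>
        obtain ⟨y, rfl⟩ := ih
        exact ⟨⟨[], [j]⟩ * y, by rw [map_mul]; simp [φ, ePath, fPath]⟩
  exact ⟨MulEquiv.ofBijective φ hb, fun x => rfl, hd⟩

end Labelling

/-- Two 2-graphs with the same relations are isomorphic, through their common normal forms. -/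
theorem HasRelations.iso {Λ : TwoGraph.{u}} {Λ' : TwoGraph.{v}} {n m : ℕ}
    {θ : Equiv.Perm (Fin n × Fin m)} (h : Λ.HasRelations θ) (h' : Λ'.HasRelations θ) :
    Iso Λ Λ' := by
  obtain ⟨l, hl⟩ := h
  obtain ⟨l', hl'⟩ := h'
  obtain ⟨φ, -, hφ⟩ := Labelling.Relations.exists_equiv.{u, 0} hl
  obtain ⟨ψ, -, hψ⟩ := Labelling.Relations.exists_equiv.{v, 0} hl'
  exact ⟨φ.symm.trans ψ, fun x => by
    rw [MulEquiv.trans_apply, hψ, ← hφ, MulEquiv.apply_symm_apply]⟩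

/-! ### Numerical invariants of a permutation of a rectangle -/

section Invariants

variable {n m : ℕ}

/-- Seven numbers attached to a permutation `θ` of the cells of a rectangle.  They are the traces
of the words `PQ`, `PR`, `P²`, `PQPᵀR`, `PRPᵀQ`, `P²QPR` and `PQPQ` in the permutation matrix `P` of
`θ` and the 0-1 matrices `Q` and `R` of the relations "in the same column" and "in the same row";
see `traceInvariants_eq_of_intertwining`.  Here they are written as cardinalities, which the kernel
can compute. -/
def traceInvariants (θ : Equiv.Perm (Fin n × Fin m)) : List ℕ :=
  [(Finset.univ.filter fun x => (θ x).2 = x.2).card,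
    (Finset.univ.filter fun x => (θ x).1 = x.1).card,
    (Finset.univ.filter fun x => θ (θ x) = x).card,
    (Finset.univ.filter fun x : (Fin n × Fin m) × (Fin n × Fin m) =>
      (θ x.1).2 = (θ x.2).2 ∧ x.2.1 = x.1.1).card,
    (Finset.univ.filter fun x : (Fin n × Fin m) × (Fin n × Fin m) =>
      (θ x.1).1 = (θ x.2).1 ∧ x.2.2 = x.1.2).card,
    (Finset.univ.filter fun x : (Fin n × Fin m) × (Fin n × Fin m) =>
      (θ (θ x.1)).2 = x.2.2 ∧ (θ x.2).1 = x.1.1).card,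
    (Finset.univ.filter fun x : (Fin n × Fin m) × (Fin n × Fin m) =>
      (θ x.1).2 = x.2.2 ∧ (θ x.2).2 = x.1.2).card]

theorem ProdConj.traceInvariants_eq {θ θ' : Equiv.Perm (Fin n × Fin m)} (h : ProdConj θ θ') :
    traceInvariants θ = traceInvariants θ' := by
  obtain ⟨s, t, h⟩ := h
  have h' : ∀ x, θ' (Equiv.prodCongr s t x) = Equiv.prodCongr s t (θ x) := h
  have one : ∀ (p q : Fin n × Fin m → Prop) [DecidablePred p] [DecidablePred q],
      (∀ x, q (Equiv.prodCongr s t x) ↔ p x) →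
        (Finset.univ.filter p).card = (Finset.univ.filter q).card := fun p q _ _ hpq =>
    Finset.card_equiv (Equiv.prodCongr s t) fun x => by simp only [Finset.mem_filter_univ, hpq]
  have two : ∀ (p q : (Fin n × Fin m) × (Fin n × Fin m) → Prop) [DecidablePred p]
      [DecidablePred q],
      (∀ x y, q (Equiv.prodCongr s t x, Equiv.prodCongr s t y) ↔ p (x, y)) →
        (Finset.univ.filter p).card = (Finset.univ.filter q).card := fun p q _ _ hpq =>
    Finset.card_equiv ((Equiv.prodCongr s t).prodCongr (Equiv.prodCongr s t)) fun x => by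
      simp only [Finset.mem_filter_univ]
      exact (hpq x.1 x.2).symm
  have fst : ∀ x, (Equiv.prodCongr s t x).1 = s x.1 := fun x => rfl
  have snd : ∀ x, (Equiv.prodCongr s t x).2 = t x.2 := fun x => rfl
  unfold traceInvariants
  congr 1
  · exact one _ _ fun x => by simp only [h', snd, EmbeddingLike.apply_eq_iff_eq]
  congr 1
  · exact one _ _ fun x => by simp only [h', fst, EmbeddingLike.apply_eq_iff_eq]
  congr 1
  · exact one _ _ fun x => by simp only [h', EmbeddingLike.apply_eq_iff_eq]
  congr 1
  · exact two _ _ fun x y => by simp only [h', fst, snd, EmbeddingLike.apply_eq_iff_eq]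
  congr 1
  · exact two _ _ fun x y => by simp only [h', fst, snd, EmbeddingLike.apply_eq_iff_eq]
  congr 1
  · exact two _ _ fun x y => by simp only [h', fst, snd, EmbeddingLike.apply_eq_iff_eq]
  congr 1
  exact two _ _ fun x y => by simp only [h', snd, EmbeddingLike.apply_eq_iff_eq]

end Invariants

/-- The conjugate of `θ` by the permutation `s` of the rows and `t` of the columns. -/
def relabel {n m : ℕ} (s : Equiv.Perm (Fin n)) (t : Equiv.Perm (Fin m))
    (θ : Equiv.Perm (Fin n × Fin m)) : Equiv.Perm (Fin n × Fin m) :=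
  (Equiv.prodCongr s t).symm.trans (θ.trans (Equiv.prodCongr s t))

theorem prodConj_relabel {n m : ℕ} (s : Equiv.Perm (Fin n)) (t : Equiv.Perm (Fin m))
    (θ : Equiv.Perm (Fin n × Fin m)) : ProdConj θ (relabel s t θ) :=
  ⟨s, t, fun c => by simp [relabel, Prod.map]⟩

/-- The values of `θ` on the cells of the `2 × 3` rectangle, read as the digits of a number. -/
def digitCode (θ : Equiv.Perm (Fin 2 × Fin 3)) : ℕ :=
  Nat.ofDigits 6 (([0, 1].product [0, 1, 2]).map fun x : Fin 2 × Fin 3 =>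
    (θ x).1.1 * 3 + (θ x).2.1)

/-- A list of representatives of all product conjugacy classes of permutations of the `2 × 3`
rectangle: the permutations that have the smallest code in their class. -/
def classReps : List (Equiv.Perm (Fin 2 × Fin 3)) :=
  (permsOfList ([0, 1].product [0, 1, 2])).filter fun θ =>
    ∀ s t, digitCode θ ≤ digitCode (relabel s t θ)

theorem exists_mem_classReps (θ : Equiv.Perm (Fin 2 × Fin 3)) :
    ∃ θ' ∈ classReps, ProdConj θ θ' := by
  obtain ⟨⟨s, t⟩, hst⟩ := Finite.exists_min
    fun p : Equiv.Perm (Fin 2) × Equiv.Perm (Fin 3) => digitCode (relabel p.1 p.2 θ)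
  refine ⟨relabel s t θ, List.mem_filter.2 ⟨mem_permsOfList_of_mem fun x _ =>
    (by decide : ∀ x : Fin 2 × Fin 3, x ∈ [0, 1].product [0, 1, 2]) x, ?_⟩,
    prodConj_relabel s t θ⟩
  · exact decide_eq_true fun s' t' => hst (s.trans s', t.trans t')

/-- On the `2 × 3` rectangle the seven traces separate the 84 product conjugacy classes. -/
theorem nodup_traceInvariants : (classReps.map traceInvariants).Nodup := by
  decide +kernel

theorem prodConj_of_traceInvariants_eq {θ θ' : Equiv.Perm (Fin 2 × Fin 3)}
    (h : traceInvariants θ = traceInvariants θ') : ProdConj θ θ' := by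
  obtain ⟨ρ, hρ, h1⟩ := exists_mem_classReps θ
  obtain ⟨ρ', hρ', h2⟩ := exists_mem_classReps θ'
  rw [h1.traceInvariants_eq, h2.traceInvariants_eq] at h
  rw [← List.inj_on_of_nodup_map nodup_traceInvariants hρ hρ' h] at h2
  exact h1.trans h2.symm

/-! ### The fourteen classes of cyclic permutations -/

instance {n m : ℕ} (θ θ' : Equiv.Perm (Fin n × Fin m)) : Decidable (ProdConj θ θ') := by
  unfold ProdConj
  infer_instance

theorem eq_of_prodConj_theta : ∀ k k' : Fin 14, ProdConj (theta k) (theta k') → k = k' := by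
  decide +kernel

/-- The hypothesis says that the cycle of `θ` through the first cell has length six. -/
theorem exists_prodConj_theta_of_pow_ne : ∀ θ : Equiv.Perm (Fin 2 × Fin 3),
    (∀ k : Fin 5, (θ ^ (k.1 + 1)) (0, 0) ≠ (0, 0)) → ∃ k, ProdConj (theta k) θ := by
  decide +kernel

theorem exists_prodConj_theta {θ : Equiv.Perm (Fin 2 × Fin 3)} (hc : θ.IsCycle)
    (hs : θ.support = Finset.univ) : ∃ k, ProdConj (theta k) θ := by
  refine exists_prodConj_theta_of_pow_ne θ fun k hk => ?_
  have h0 : θ (0, 0) ≠ (0, 0) := Equiv.Perm.mem_support.1 (by simp [hs])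
  have h1 := orderOf_dvd_of_pow_eq_one ((hc.pow_eq_one_iff' h0).2 hk)
  rw [hc.orderOf, hs] at h1
  have := Nat.le_of_dvd (by omega) h1
  simp at this
  omega

theorem theta_isCycle : ∀ k, (theta k).IsCycle := by
  intro k
  fin_cases k <;>
    exact List.isCycle_formPerm (by decide) (by decide)

theorem theta_support : ∀ k, (theta k).support = Finset.univ := by
  decide +kernel

/-! ### Intertwining permutation matrices by a tensor product -/

section Trace

open Matrix Kronecker

variable {n m : ℕ}

/-- The 0-1 matrix of the relation "in the same column". -/
def sameColumn (n m : ℕ) : Matrix (Fin n × Fin m) (Fin n × Fin m) ℂ :=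
  Matrix.of fun x y => if x.2 = y.2 then 1 else 0

/-- The 0-1 matrix of the relation "in the same row". -/
def sameRow (n m : ℕ) : Matrix (Fin n × Fin m) (Fin n × Fin m) ℂ :=
  Matrix.of fun x y => if x.1 = y.1 then 1 else 0

theorem sameColumn_eq_kronecker :
    sameColumn n m = (Matrix.of fun _ _ => (1 : ℂ) : Matrix (Fin n) (Fin n) ℂ) ⊗ₖ 1 := by
  ext x y
  simp [sameColumn, Matrix.one_apply]

theorem sameRow_eq_kronecker :
    sameRow n m = 1 ⊗ₖ (Matrix.of fun _ _ => (1 : ℂ) : Matrix (Fin m) (Fin m) ℂ) := by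
  ext x y
  simp [sameRow, Matrix.one_apply]

theorem trace_mul_eq_card {ι : Type*} [Fintype ι] {X Y : Matrix ι ι ℂ} (p : ι × ι → Prop)
    [DecidablePred p] (h : ∀ x y, X x y * Y y x = if p (x, y) then 1 else 0) :
    (X * Y).trace = (Finset.univ.filter p).card := by
  simp only [Matrix.trace, Matrix.diag, Matrix.mul_apply, h]
  rw [← Fintype.sum_prod_type' (f := fun x y => if p (x, y) then (1 : ℂ) else 0)]
  simp

theorem trace_eq_card {ι : Type*} [Fintype ι] {X : Matrix ι ι ℂ} (p : ι → Prop)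
    [DecidablePred p] (h : ∀ x, X x x = if p x then 1 else 0) :
    X.trace = (Finset.univ.filter p).card := by
  simp only [Matrix.trace, Matrix.diag, h]
  simp

/-- If the permutation matrices of `θ` and `θ'` are intertwined by an invertible matrix `A ⊗ B`
whose factors commute with the matrices of ones, then `A ⊗ B` intertwines all words in the
permutation matrices, their transposes and the matrices `sameColumn` and `sameRow`, so that these
words have equal traces. -/
theorem traceInvariants_eq_of_intertwining {θ θ' : Equiv.Perm (Fin n × Fin m)}
    {A A' : Matrix (Fin n) (Fin n) ℂ} {B B' : Matrix (Fin m) (Fin m) ℂ} (hA : A * A' = 1)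
    (hB : B * B' = 1) (hAJ : Commute A (Matrix.of fun _ _ => 1))
    (hBJ : Commute B (Matrix.of fun _ _ => 1))
    (h : ∀ x y, A (θ x).1 (θ' y).1 * B (θ x).2 (θ' y).2 = A x.1 y.1 * B x.2 y.2) :
    traceInvariants θ = traceInvariants θ' := by
  set M := A ⊗ₖ B with hM
  have hMN : M * (A' ⊗ₖ B') = 1 := by
    rw [hM, ← Matrix.mul_kronecker_mul, hA, hB, Matrix.one_kronecker_one]
  have hNM := mul_eq_one_comm.1 hMN
  let P := θ.permMatrix ℂ
  let P' := θ'.permMatrix ℂ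
  have hP : P * M = M * P' := by
    ext x y
    rw [PEquiv.toMatrix_toPEquiv_mul, PEquiv.mul_toMatrix_toPEquiv]
    simpa [hM] using h x (θ'.symm y)
  have hPt : Equiv.Perm.permMatrix ℂ θ.symm * M = M * Equiv.Perm.permMatrix ℂ θ'.symm := by
    ext x y
    rw [PEquiv.toMatrix_toPEquiv_mul, PEquiv.mul_toMatrix_toPEquiv]
    simpa [hM] using (h (θ.symm x) y).symm
  have hQ : sameColumn n m * M = M * sameColumn n m := by
    rw [hM, sameColumn_eq_kronecker, ← Matrix.mul_kronecker_mul, ← Matrix.mul_kronecker_mul,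
      hAJ.eq, one_mul, mul_one]
  have hR : sameRow n m * M = M * sameRow n m := by
    rw [hM, sameRow_eq_kronecker, ← Matrix.mul_kronecker_mul, ← Matrix.mul_kronecker_mul,
      hBJ.eq, one_mul, mul_one]
  have mul : ∀ {W₁ W₁' W₂ W₂' : Matrix (Fin n × Fin m) (Fin n × Fin m) ℂ}, W₁ * M = M * W₁' →
      W₂ * M = M * W₂' → W₁ * W₂ * M = M * (W₁' * W₂') := fun {W₁ W₁' W₂ W₂'} h₁ h₂ => by
    rw [mul_assoc, h₂, ← mul_assoc, h₁, mul_assoc]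
  have tr : ∀ {W W' : Matrix (Fin n × Fin m) (Fin n × Fin m) ℂ}, W * M = M * W' →
      W.trace = W'.trace := fun {W W'} hW => by
    rw [← mul_one W, ← hMN, ← mul_assoc, hW, mul_assoc, Matrix.trace_mul_comm, mul_assoc, hNM,
      mul_one]
  have ite_mul_ite : ∀ (p q : Prop) [Decidable p] [Decidable q],
      (if p then (1 : ℂ) else 0) * (if q then 1 else 0) = if p ∧ q then 1 else 0 := by
    intro p q _ _
    by_cases p <;> by_cases q <;> simp [*]
  have t1 : ∀ σ : Equiv.Perm (Fin n × Fin m), (σ.permMatrix ℂ * sameColumn n m).trace =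
      (Finset.univ.filter fun x => (σ x).2 = x.2).card := fun σ =>
    trace_eq_card _ fun x => by simp [PEquiv.toMatrix_toPEquiv_mul, sameColumn]
  have t2 : ∀ σ : Equiv.Perm (Fin n × Fin m), (σ.permMatrix ℂ * sameRow n m).trace =
      (Finset.univ.filter fun x => (σ x).1 = x.1).card := fun σ =>
    trace_eq_card _ fun x => by simp [PEquiv.toMatrix_toPEquiv_mul, sameRow]
  have t3 : ∀ σ : Equiv.Perm (Fin n × Fin m), (σ.permMatrix ℂ * σ.permMatrix ℂ).trace =
      (Finset.univ.filter fun x => σ (σ x) = x).card := fun σ =>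
    trace_eq_card _ fun x => by
      rw [← mul_one (_ * _), mul_assoc, PEquiv.toMatrix_toPEquiv_mul, PEquiv.toMatrix_toPEquiv_mul]
      simp [Matrix.one_apply]
  have t4 : ∀ σ : Equiv.Perm (Fin n × Fin m),
      (σ.permMatrix ℂ * sameColumn n m * Equiv.Perm.permMatrix ℂ σ.symm * sameRow n m).trace =
        (Finset.univ.filter fun x : (Fin n × Fin m) × (Fin n × Fin m) =>
          (σ x.1).2 = (σ x.2).2 ∧ x.2.1 = x.1.1).card := fun σ =>
    trace_mul_eq_card _ fun x y => by
      rw [PEquiv.mul_toMatrix_toPEquiv, PEquiv.toMatrix_toPEquiv_mul]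
      simp only [sameColumn, sameRow, Matrix.submatrix_apply, Matrix.of_apply, ite_mul_ite,
        Equiv.symm_symm, id_eq]
  have t5 : ∀ σ : Equiv.Perm (Fin n × Fin m),
      (σ.permMatrix ℂ * sameRow n m * Equiv.Perm.permMatrix ℂ σ.symm * sameColumn n m).trace =
        (Finset.univ.filter fun x : (Fin n × Fin m) × (Fin n × Fin m) =>
          (σ x.1).1 = (σ x.2).1 ∧ x.2.2 = x.1.2).card := fun σ =>
    trace_mul_eq_card _ fun x y => by
      rw [PEquiv.mul_toMatrix_toPEquiv, PEquiv.toMatrix_toPEquiv_mul]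
      simp only [sameColumn, sameRow, Matrix.submatrix_apply, Matrix.of_apply, ite_mul_ite,
        Equiv.symm_symm, id_eq]
  have t6 : ∀ σ : Equiv.Perm (Fin n × Fin m),
      (σ.permMatrix ℂ * (σ.permMatrix ℂ * sameColumn n m) *
        (σ.permMatrix ℂ * sameRow n m)).trace =
        (Finset.univ.filter fun x : (Fin n × Fin m) × (Fin n × Fin m) =>
          (σ (σ x.1)).2 = x.2.2 ∧ (σ x.2).1 = x.1.1).card := fun σ =>
    trace_mul_eq_card _ fun x y => by
      simp only [PEquiv.toMatrix_toPEquiv_mul]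
      simp only [sameColumn, sameRow, Matrix.submatrix_apply, Matrix.of_apply, ite_mul_ite,
        id_eq]
  have t7 : ∀ σ : Equiv.Perm (Fin n × Fin m),
      (σ.permMatrix ℂ * sameColumn n m * (σ.permMatrix ℂ * sameColumn n m)).trace =
        (Finset.univ.filter fun x : (Fin n × Fin m) × (Fin n × Fin m) =>
          (σ x.1).2 = x.2.2 ∧ (σ x.2).2 = x.1.2).card := fun σ =>
    trace_mul_eq_card _ fun x y => by
      simp only [PEquiv.toMatrix_toPEquiv_mul]
      simp only [sameColumn, Matrix.submatrix_apply, Matrix.of_apply, ite_mul_ite, id_eq]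
  unfold traceInvariants
  congr 1
  · exact_mod_cast (t1 θ).symm.trans ((tr (mul hP hQ)).trans (t1 θ'))
  congr 1
  · exact_mod_cast (t2 θ).symm.trans ((tr (mul hP hR)).trans (t2 θ'))
  congr 1
  · exact_mod_cast (t3 θ).symm.trans ((tr (mul hP hP)).trans (t3 θ'))
  congr 1
  · exact_mod_cast (t4 θ).symm.trans ((tr (mul (mul (mul hP hQ) hPt) hR)).trans (t4 θ'))
  congr 1
  · exact_mod_cast (t5 θ).symm.trans ((tr (mul (mul (mul hP hR) hPt) hQ)).trans (t5 θ'))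
  congr 1
  · exact_mod_cast (t6 θ).symm.trans
      ((tr (mul (mul hP (mul hP hQ)) (mul hP hR))).trans (t6 θ'))
  congr 1
  exact_mod_cast (t7 θ).symm.trans ((tr (mul (mul hP hQ) (mul hP hQ))).trans (t7 θ'))

end Trace

/-! ### Coefficients of elements of the Toeplitz algebra -/

section Toeplitz

open scoped InnerProductSpace

variable {Λ : TwoGraph.{u}}

theorem fock_ext {E : Type*} [TopologicalSpace E] [T2Space E] [AddCommMonoid E] [Module ℂ E]
    {F G : Λ.Fock →L[ℂ] E} (h : ∀ v, F (Λ.fockBasis v) = G (Λ.fockBasis v)) : F = G :=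
  ContinuousLinearMap.ext_on (s := Set.range Λ.fockBasis)
    (by
      rw [Submodule.dense_iff_topologicalClosure_eq_top]
      exact Λ.fockBasis.dense_span) (by
      rintro _ ⟨v, rfl⟩
      exact h v)

theorem shift_mul (w w' : Λ.Path) : Λ.shift (w * w') = Λ.shift w * Λ.shift w' :=
  fock_ext fun v => by
    rw [mul_apply_eq_comp, shift_apply_basis, shift_apply_basis, shift_apply_basis,
      mul_assoc]

theorem shift_one : Λ.shift 1 = 1 :=
  fock_ext fun v => by rw [shift_apply_basis, one_mul, one_apply_eq_self]

theorem toeplitzShift_mul (w w' : Λ.Path) :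
    Λ.toeplitzShift (w * w') = Λ.toeplitzShift w * Λ.toeplitzShift w' :=
  Subtype.ext (shift_mul w w')

theorem toeplitzShift_one : Λ.toeplitzShift 1 = 1 := Subtype.ext shift_one

/-- The shifts form a monoid, so that the algebra generated by them is their linear span. -/
theorem dense_span_toeplitzShift :
    Dense (Submodule.span ℂ (Set.range Λ.toeplitzShift) : Set Λ.toeplitz) := by
  intro a
  rw [Topology.IsInducing.subtypeVal.closure_eq_preimage_closure_image]
  have h1 : Submonoid.closure (Set.range Λ.shift) =
      MonoidHom.mrange (⟨⟨Λ.shift, shift_one⟩, shift_mul⟩ : Λ.Path →* _) :=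
    Submonoid.closure_eq_of_le (by rintro _ ⟨w, rfl⟩; exact ⟨w, rfl⟩)
      (by rintro _ ⟨w, rfl⟩; exact Submonoid.subset_closure ⟨w, rfl⟩)
  have h2 : (Subtype.val '' (Submodule.span ℂ (Set.range Λ.toeplitzShift) : Set Λ.toeplitz)) =
      (Algebra.adjoin ℂ (Set.range Λ.shift) : Set (Λ.Fock →L[ℂ] Λ.Fock)) := by
    have h3 := Submodule.map_span (Subalgebra.toSubmodule Λ.toeplitz).subtype
      (Set.range Λ.toeplitzShift)
    rw [← Set.range_comp] at h3
    have h4 := Algebra.adjoin_eq_span ℂ (Set.range Λ.shift)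
    rw [h1] at h4
    have h5 := h3.trans h4.symm
    exact congrArg (fun S : Submodule ℂ _ => (S : Set (Λ.Fock →L[ℂ] Λ.Fock))) h5
  exact h2 ▸ a.2

theorem toeplitz_ext {E : Type*} [TopologicalSpace E] [T2Space E] [AddCommMonoid E] [Module ℂ E]
    {F G : Λ.toeplitz →L[ℂ] E} (h : ∀ w, F (Λ.toeplitzShift w) = G (Λ.toeplitzShift w)) :
    F = G :=
  ContinuousLinearMap.ext_on dense_span_toeplitzShift (by
    rintro _ ⟨w, rfl⟩
    exact h w)

/-- A product formula for functionals on the Toeplitz algebra has to be checked on shifts only. -/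
theorem map_mul_eq_sum {ι : Type*} (s : Finset ι) (D : Λ.toeplitz →L[ℂ] ℂ)
    (P Q : ι → Λ.toeplitz →L[ℂ] ℂ)
    (h : ∀ w v, D (Λ.toeplitzShift (w * v)) =
      ∑ i ∈ s, P i (Λ.toeplitzShift w) * Q i (Λ.toeplitzShift v)) (a b : Λ.toeplitz) :
    D (a * b) = ∑ i ∈ s, P i a * Q i b := by
  have h1 : ∀ w b, D (Λ.toeplitzShift w * b) = ∑ i ∈ s, P i (Λ.toeplitzShift w) * Q i b := by
    intro w b
    have h2 : D ∘L ContinuousLinearMap.mul ℂ Λ.toeplitz (Λ.toeplitzShift w) =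
        ∑ i ∈ s, P i (Λ.toeplitzShift w) • Q i :=
      toeplitz_ext fun v => by
        simpa [toeplitzShift_mul, sum_apply] using h w v
    simpa [sum_apply] using congrArg (fun F => F b) h2
  have h2 : D ∘L (ContinuousLinearMap.mul ℂ Λ.toeplitz).flip b = ∑ i ∈ s, Q i b • P i :=
    toeplitz_ext fun w => by
      simpa [sum_apply, mul_comm] using h1 w b
  simpa [sum_apply, mul_comm] using congrArg (fun F => F a) h2

/-- The functional `a ↦ ⟪η, a ξ_1⟫` on the Toeplitz algebra. -/
noncomputable def vacuumFunctional (η : Λ.Fock) : Λ.toeplitz →L[ℂ] ℂ :=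
  (innerSL ℂ η) ∘L (ContinuousLinearMap.apply ℂ Λ.Fock (Λ.fockBasis 1)) ∘L
    (Subalgebra.toSubmodule Λ.toeplitz).subtypeL

theorem vacuumFunctional_apply (η : Λ.Fock) (a : Λ.toeplitz) :
    vacuumFunctional η a = ⟪η, (a : Λ.Fock →L[ℂ] Λ.Fock) (Λ.fockBasis 1)⟫_ℂ := rfl

theorem vacuumFunctional_toeplitzShift (η : Λ.Fock) (w : Λ.Path) :
    vacuumFunctional η (Λ.toeplitzShift w) = ⟪η, Λ.fockBasis w⟫_ℂ := by
  rw [vacuumFunctional_apply]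
  change ⟪η, Λ.shift w (Λ.fockBasis 1)⟫_ℂ = _
  rw [shift_apply_basis, mul_one]

/-- The coefficient at the path `x` in the formal expansion `∑ a_x L_x` of an element `a` of the
Toeplitz algebra. -/
noncomputable def coeff (x : Λ.Path) : Λ.toeplitz →L[ℂ] ℂ := vacuumFunctional (Λ.fockBasis x)

open Classical in
theorem coeff_toeplitzShift (x w : Λ.Path) :
    coeff x (Λ.toeplitzShift w) = if w = x then 1 else 0 := by
  rw [coeff, vacuumFunctional_toeplitzShift,
    orthonormal_iff_ite.1 Λ.fockBasis.orthonormal]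
  exact if_congr eq_comm rfl rfl

/-- Coefficients of a product: the sum runs over all factorisations of `x`. -/
theorem coeff_mul (x : Λ.Path) (s : Finset (Λ.Path × Λ.Path))
    (hs : ∀ w v, w * v = x ↔ (w, v) ∈ s) (a b : Λ.toeplitz) :
    coeff x (a * b) = ∑ p ∈ s, coeff p.1 a * coeff p.2 b := by
  classical
  refine map_mul_eq_sum s (coeff x) (fun p => coeff p.1) (fun p => coeff p.2) (fun w v => ?_) a b
  simp only [coeff_toeplitzShift]
  have h : ∀ p : Λ.Path × Λ.Path, ((if w = p.1 then (1 : ℂ) else 0) *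
      if v = p.2 then 1 else 0) = if (w, v) = p then 1 else 0 := by
    rintro ⟨p, q⟩
    by_cases h1 : w = p <;> by_cases h2 : v = q <;> simp [h1, h2]
  simp only [h, Finset.sum_ite_eq, hs]

theorem coeff_one_mul (a b : Λ.toeplitz) : coeff 1 (a * b) = coeff 1 a * coeff 1 b := by
  rw [coeff_mul 1 {(1, 1)}, Finset.sum_singleton]
  intro w v
  rw [Finset.mem_singleton, Prod.mk.injEq]
  constructor
  · intro h
    have hd := congrArg Λ.d h
    rw [Λ.d_mul, Λ.d_one, Prod.ext_iff] at hd
    simp at hd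
    exact ⟨eq_one_of_d_eq_zero (Prod.ext hd.1.1 hd.2.1),
      eq_one_of_d_eq_zero (Prod.ext hd.1.2 hd.2.2)⟩
  · rintro ⟨rfl, rfl⟩
    exact mul_one 1

/-- The product formula with the two factorisations of `x` that involve the unit split off. -/
theorem coeff_mul_of_proper {x : Λ.Path} (hx : x ≠ 1) (s : Finset (Λ.Path × Λ.Path))
    (hs : ∀ w v, (w * v = x ∧ w ≠ 1 ∧ v ≠ 1) ↔ (w, v) ∈ s) (a b : Λ.toeplitz) :
    coeff x (a * b) = coeff 1 a * coeff x b + coeff x a * coeff 1 b +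
      ∑ p ∈ s, coeff p.1 a * coeff p.2 b := by
  classical
  have h1 : ((1, x) : Λ.Path × Λ.Path) ∉ insert (x, 1) s := by
    rw [Finset.mem_insert, ← hs]
    simp [hx.symm]
  have h2 : ((x, 1) : Λ.Path × Λ.Path) ∉ s := by
    rw [← hs]
    simp
  rw [coeff_mul x (insert (1, x) (insert (x, 1) s)), Finset.sum_insert h1, Finset.sum_insert h2,
    add_assoc]
  intro w v
  rw [Finset.mem_insert, Finset.mem_insert, ← hs, Prod.mk.injEq, Prod.mk.injEq]
  constructor
  · intro h
    by_cases hw : w = 1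
    · subst hw
      exact Or.inl ⟨rfl, by simpa using h⟩
    by_cases hv : v = 1
    · subst hv
      exact Or.inr (Or.inl ⟨by simpa using h, rfl⟩)
    exact Or.inr (Or.inr ⟨h, hw, hv⟩)
  · rintro (⟨rfl, rfl⟩ | ⟨rfl, rfl⟩ | h)
    · exact one_mul _
    · exact mul_one _
    · exact h.1

theorem d_ne_zero {x : Λ.Path} (hx : x ≠ 1) : Λ.d x ≠ 0 := fun h => hx (eq_one_of_d_eq_zero h)

theorem ne_one_of_d {x : Λ.Path} {p : ℕ × ℕ} (h : Λ.d x = p) (hp : p ≠ 0) : x ≠ 1 := by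
  rintro rfl
  exact hp (h.symm.trans Λ.d_one)

theorem one_le_degree {x : Λ.Path} (hx : x ≠ 1) : 1 ≤ (Λ.d x).1 + (Λ.d x).2 := by
  by_contra h
  exact d_ne_zero hx (Prod.ext (by simp; omega) (by simp; omega))

end Toeplitz

/-- The edges of `Λ` of both degrees, as a single family. -/
def Labelling.edge {Λ : TwoGraph.{u}} {n m : ℕ} (l : Λ.Labelling n m) : Fin n ⊕ Fin m → Λ.Path :=
  Sum.elim (fun i => l.e i) (fun j => l.f j)

namespace Labelling

variable {Λ : TwoGraph.{u}} {n m : ℕ} (l : Λ.Labelling n m)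

theorem degree_edge (g : Fin n ⊕ Fin m) : (Λ.d (l.edge g)).1 + (Λ.d (l.edge g)).2 = 1 := by
  cases g with
  | inl i => simp [edge, l.d_e]
  | inr j => simp [edge, l.d_f]

theorem edge_ne_one (g : Fin n ⊕ Fin m) : l.edge g ≠ 1 := fun h => by
  have := l.degree_edge g
  rw [h, Λ.d_one] at this
  simp at this

theorem edge_inj {g h : Fin n ⊕ Fin m} : l.edge g = l.edge h ↔ g = h := by
  constructor
  · intro hgh
    have hd := congrArg Λ.d hgh
    cases g with
    | inl i =>
      cases h with
      | inl k => rw [l.e_inj.1 hgh]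
      | inr j => simp [edge, l.d_e, l.d_f] at hd
    | inr j =>
      cases h with
      | inl k => simp [edge, l.d_e, l.d_f] at hd
      | inr k => rw [l.f_inj.1 hgh]
  · rintro rfl
    rfl

theorem edge_induction {P : Λ.Path → Prop} (one : P 1)
    (mul : ∀ g x, P x → P (l.edge g * x)) (x : Λ.Path) : P x :=
  l.path_induction one (fun i => mul (Sum.inl i)) (fun j => mul (Sum.inr j)) x

theorem coeff_edge (g h : Fin n ⊕ Fin m) :
    coeff (l.edge h) (Λ.toeplitzShift (l.edge g)) = if g = h then 1 else 0 := by
  classical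
  rw [coeff_toeplitzShift]
  exact if_congr l.edge_inj rfl rfl

theorem coeff_one_edge (g : Fin n ⊕ Fin m) : coeff 1 (Λ.toeplitzShift (l.edge g)) = 0 := by
  rw [coeff_toeplitzShift, if_neg (l.edge_ne_one g)]

/-- The coefficient at an edge is a point derivation at the character `coeff 1`. -/
theorem coeff_edge_mul (g : Fin n ⊕ Fin m) (a b : Λ.toeplitz) :
    coeff (l.edge g) (a * b) = coeff 1 a * coeff (l.edge g) b + coeff (l.edge g) a * coeff 1 b := by
  rw [coeff_mul_of_proper (l.edge_ne_one g) ∅, Finset.sum_empty, add_zero]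
  intro w v
  simp only [Finset.notMem_empty, iff_false]
  rintro ⟨h, hw, hv⟩
  have h1 := l.degree_edge g
  rw [← h, Λ.d_mul, Prod.fst_add, Prod.snd_add] at h1
  have := one_le_degree hw
  have := one_le_degree hv
  omega

theorem coeff_e_mul_e (i i' : Fin n) {a b : Λ.toeplitz} (ha : coeff 1 a = 0) (hb : coeff 1 b = 0) :
    coeff ((l.e i : Λ.Path) * (l.e i' : Λ.Path)) (a * b) = coeff (l.e i) a * coeff (l.e i') b := by
  have hd : Λ.d ((l.e i : Λ.Path) * (l.e i' : Λ.Path)) = (2, 0) := by rw [Λ.d_mul, l.d_e, l.d_e]; rfl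
  rw [coeff_mul_of_proper (ne_one_of_d hd (by decide)) {((l.e i : Λ.Path), (l.e i' : Λ.Path))},
    Finset.sum_singleton, ha, hb]
  · ring
  intro w v
  rw [Finset.mem_singleton, Prod.mk.injEq]
  constructor
  · rintro ⟨h, hw, hv⟩
    have h1 := congrArg Λ.d h
    rw [hd, Λ.d_mul, Prod.ext_iff] at h1
    simp only [Prod.fst_add, Prod.snd_add] at h1
    have := one_le_degree hw
    have := one_le_degree hv
    exact eq_and_eq_of_mul_eq_mul h (by rw [l.d_e]; exact Prod.ext (by simp; omega) (by simp; omega))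
  · rintro ⟨rfl, rfl⟩
    exact ⟨rfl, ne_one_of_d (l.d_e i) (by decide), ne_one_of_d (l.d_e i') (by decide)⟩

theorem coeff_f_mul_f (j j' : Fin m) {a b : Λ.toeplitz} (ha : coeff 1 a = 0) (hb : coeff 1 b = 0) :
    coeff ((l.f j : Λ.Path) * (l.f j' : Λ.Path)) (a * b) = coeff (l.f j) a * coeff (l.f j') b := by
  have hd : Λ.d ((l.f j : Λ.Path) * (l.f j' : Λ.Path)) = (0, 2) := by rw [Λ.d_mul, l.d_f, l.d_f]; rfl
  rw [coeff_mul_of_proper (ne_one_of_d hd (by decide)) {((l.f j : Λ.Path), (l.f j' : Λ.Path))},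
    Finset.sum_singleton, ha, hb]
  · ring
  intro w v
  rw [Finset.mem_singleton, Prod.mk.injEq]
  constructor
  · rintro ⟨h, hw, hv⟩
    have h1 := congrArg Λ.d h
    rw [hd, Λ.d_mul, Prod.ext_iff] at h1
    simp only [Prod.fst_add, Prod.snd_add] at h1
    have := one_le_degree hw
    have := one_le_degree hv
    exact eq_and_eq_of_mul_eq_mul h (by rw [l.d_f]; exact Prod.ext (by simp; omega) (by simp; omega))
  · rintro ⟨rfl, rfl⟩
    exact ⟨rfl, ne_one_of_d (l.d_f j) (by decide), ne_one_of_d (l.d_f j') (by decide)⟩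

variable {l} in
theorem Relations.coeff_e_mul_f {θ : Equiv.Perm (Fin n × Fin m)} (hl : l.Relations θ) (i : Fin n)
    (j : Fin m) {a b : Λ.toeplitz} (ha : coeff 1 a = 0) (hb : coeff 1 b = 0) :
    coeff ((l.e i : Λ.Path) * (l.f j : Λ.Path)) (a * b) = coeff (l.e i) a * coeff (l.f j) b +
      coeff (l.f (θ (i, j)).2) a * coeff (l.e (θ (i, j)).1) b := by
  classical
  have hd : Λ.d ((l.e i : Λ.Path) * (l.f j : Λ.Path)) = (1, 1) := by rw [Λ.d_mul, l.d_e, l.d_f]; rfl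
  have hne : ((l.e i : Λ.Path), (l.f j : Λ.Path)) ≠
      ((l.f (θ (i, j)).2 : Λ.Path), (l.e (θ (i, j)).1 : Λ.Path)) := fun h => by
    have h1 := congrArg (fun p => Λ.d p.1) h
    simp [l.d_e, l.d_f] at h1
  rw [coeff_mul_of_proper (ne_one_of_d hd (by decide)) {((l.e i : Λ.Path), (l.f j : Λ.Path)),
      ((l.f (θ (i, j)).2 : Λ.Path), (l.e (θ (i, j)).1 : Λ.Path))},
    Finset.sum_pair hne, ha, hb]
  · ring
  intro w v
  rw [Finset.mem_insert, Finset.mem_singleton, Prod.mk.injEq, Prod.mk.injEq]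
  constructor
  · rintro ⟨h, hw, hv⟩
    have h1 := congrArg Λ.d h
    rw [hd, Λ.d_mul, Prod.ext_iff] at h1
    simp only [Prod.fst_add, Prod.snd_add] at h1
    have := one_le_degree hw
    have := one_le_degree hv
    rcases Nat.eq_zero_or_pos (Λ.d w).1 with h0 | h0
    · right
      exact eq_and_eq_of_mul_eq_mul (h.trans (hl i j))
        (by rw [l.d_f]; exact Prod.ext (by simp; omega) (by simp; omega))
    · left
      exact eq_and_eq_of_mul_eq_mul h
        (by rw [l.d_e]; exact Prod.ext (by simp; omega) (by simp; omega))
  · rintro (⟨rfl, rfl⟩ | ⟨rfl, rfl⟩)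
    · exact ⟨rfl, ne_one_of_d (l.d_e _) (by decide), ne_one_of_d (l.d_f _) (by decide)⟩
    · exact ⟨(hl i j).symm, ne_one_of_d (l.d_f _) (by decide), ne_one_of_d (l.d_e _) (by decide)⟩

/-- A continuous point derivation is determined by its values at the edges. -/
theorem derivation_ext {ρ : Λ.toeplitz → ℂ} (hρ : ρ 1 = 1) {D D' : Λ.toeplitz →L[ℂ] ℂ}
    (hD : ∀ a b, D (a * b) = ρ a * D b + D a * ρ b)
    (hD' : ∀ a b, D' (a * b) = ρ a * D' b + D' a * ρ b)
    (h : ∀ g, D (Λ.toeplitzShift (l.edge g)) = D' (Λ.toeplitzShift (l.edge g))) : D = D' := by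
  refine toeplitz_ext fun w => ?_
  induction w using l.edge_induction with
  | one =>
    have h1 := hD 1 1
    have h2 := hD' 1 1
    rw [mul_one, hρ, one_mul, mul_one, left_eq_add] at h1 h2
    rw [toeplitzShift_one, h1, h2]
  | mul g w ih => rw [toeplitzShift_mul, hD, hD', h, ih]

/-- A character is determined by its values at the edges. -/
theorem character_ext {ρ ρ' : Λ.toeplitz →L[ℂ] ℂ} (h1 : ρ 1 = 1) (h1' : ρ' 1 = 1)
    (hρ : ∀ a b, ρ (a * b) = ρ a * ρ b) (hρ' : ∀ a b, ρ' (a * b) = ρ' a * ρ' b)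
    (h : ∀ g, ρ (Λ.toeplitzShift (l.edge g)) = ρ' (Λ.toeplitzShift (l.edge g))) : ρ = ρ' := by
  refine toeplitz_ext fun w => ?_
  induction w using l.edge_induction with
  | one => rw [toeplitzShift_one, h1, h1']
  | mul g w ih => rw [toeplitzShift_mul, hρ, hρ', h, ih]

end Labelling

section RowIsometry

open scoped InnerProductSpace

variable {Λ : TwoGraph.{u}}

theorem inner_shift_shift_eq_zero {w v : Λ.Path} (hd : Λ.d w = Λ.d v) (hne : w ≠ v)
    (ξ η : Λ.Fock) : ⟪Λ.shift w ξ, Λ.shift v η⟫_ℂ = 0 := by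
  have h1 : ∀ b ξ, ⟪Λ.shift v (Λ.fockBasis b), Λ.shift w ξ⟫_ℂ = 0 := by
    intro b ξ
    have h2 : innerSL ℂ (Λ.shift v (Λ.fockBasis b)) ∘L Λ.shift w = 0 := fock_ext fun c => by
      rw [ContinuousLinearMap.comp_apply, innerSL_apply_apply, shift_apply_basis,
        shift_apply_basis, Λ.fockBasis.orthonormal.2, zero_apply]
      intro h
      exact hne (eq_and_eq_of_mul_eq_mul h hd.symm).1.symm
    exact congrArg (fun F => F ξ) h2
  have h2 : innerSL ℂ (Λ.shift w ξ) ∘L Λ.shift v = 0 := fock_ext fun c => by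
    rw [ContinuousLinearMap.comp_apply, innerSL_apply_apply, ← inner_conj_symm, h1]
    simp
  exact congrArg (fun F => F η) h2

/-- The shifts by different paths of the same degree have orthogonal ranges, so that a linear
combination of them has norm at most (in fact, equal to) the Euclidean norm of the
coefficients. -/
theorem norm_sum_smul_toeplitzShift_sq_le {ι : Type*} [Fintype ι] (g : ι → Λ.Path)
    (hg : Function.Injective g) (hd : ∀ i j, Λ.d (g i) = Λ.d (g j)) (c : ι → ℂ) :
    ‖∑ i, c i • Λ.toeplitzShift (g i)‖ ^ 2 ≤ ∑ i, ‖c i‖ ^ 2 := by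
  have h0 : ((∑ i, c i • Λ.toeplitzShift (g i) : Λ.toeplitz) : Λ.Fock →L[ℂ] Λ.Fock) =
      ∑ i, c i • Λ.shift (g i) := by
    rw [AddSubmonoidClass.coe_finsetSum]
    rfl
  have ho : OrthogonalFamily ℂ (fun _ : ι => Λ.Fock) fun i =>
      (Λ.orthonormal_shift (g i)).orthogonalFamily.linearIsometry := fun i j hij ξ η =>
    inner_shift_shift_eq_zero (hd i j) (hg.ne hij) ξ η
  have h1 : ∀ ξ : Λ.Fock, ‖(∑ i, c i • Λ.shift (g i)) ξ‖ ^ 2 = (∑ i, ‖c i‖ ^ 2) * ‖ξ‖ ^ 2 := by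
    intro ξ
    have h2 := ho.norm_sum (fun i => c i • ξ) Finset.univ
    simp only [norm_smul, mul_pow, map_smul, ← Finset.sum_mul] at h2
    rw [← h2, sum_apply]
    rfl
  have h3 : ‖∑ i, c i • Λ.shift (g i)‖ ≤ √(∑ i, ‖c i‖ ^ 2) :=
    ContinuousLinearMap.opNorm_le_bound _ (Real.sqrt_nonneg _) fun ξ => by
      rw [← Real.sqrt_sq (norm_nonneg ξ), ← Real.sqrt_mul (by positivity), ← h1,
        Real.sqrt_sq (norm_nonneg _)]
  change ‖((∑ i, c i • Λ.toeplitzShift (g i) : Λ.toeplitz) : Λ.Fock →L[ℂ] Λ.Fock)‖ ^ 2 ≤ _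
  rw [h0, ← Real.sqrt_le_sqrt_iff (by positivity),
    Real.sqrt_sq (norm_nonneg _)]
  exact h3

end RowIsometry

/-- An isomorphism `φ` of 2-graphs induces the unitary `ξ_x ↦ ξ_{φ x}`, and conjugation by it maps
`L_w` to `L_{φ w}`. -/
theorem Iso.toeplitzIsometric {Λ : TwoGraph.{u}} {Λ' : TwoGraph.{v}} (h : Iso Λ Λ') :
    ToeplitzIsometric Λ Λ' := by
  obtain ⟨φ, -⟩ := h
  have ho : Orthonormal ℂ fun x => Λ'.fockBasis (φ x) :=
    Λ'.fockBasis.orthonormal.comp _ φ.injective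
  let b : HilbertBasis Λ.Path ℂ Λ'.Fock := HilbertBasis.mk ho (by
    have : Set.range (fun x => Λ'.fockBasis (φ x)) = Set.range Λ'.fockBasis :=
      φ.surjective.range_comp Λ'.fockBasis
    rw [this, Λ'.fockBasis.dense_span])
  let U : Λ.Fock ≃ₗᵢ[ℂ] Λ'.Fock := Λ.fockBasis.repr.trans b.repr.symm
  have hU : ∀ x, U (Λ.fockBasis x) = Λ'.fockBasis (φ x) := fun x => by
    classical
    change b.repr.symm (Λ.fockBasis.repr (Λ.fockBasis x)) = _
    rw [HilbertBasis.repr_self, HilbertBasis.repr_symm_single]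
    simp [b]
  let E := U.conjStarAlgEquiv.toAlgEquiv
  have hE : ∀ a, ‖E a‖ = ‖a‖ := fun a => by
    refine le_antisymm (ContinuousLinearMap.opNorm_le_bound _ (norm_nonneg _) fun x => ?_)
      (ContinuousLinearMap.opNorm_le_bound _ (norm_nonneg _) fun x => ?_)
    · change ‖U (a (U.symm x))‖ ≤ _
      rw [U.norm_map, ← U.symm.norm_map x]
      exact a.le_opNorm _
    · have h1 := (E a).le_opNorm (U x)
      change ‖U (a (U.symm (U x)))‖ ≤ _ at h1
      rwa [U.symm_apply_apply, U.norm_map, U.norm_map] at h1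
  have hiso : Isometry E := AddMonoidHomClass.isometry_of_norm E hE
  have hshift : ∀ w, E (Λ.shift w) = Λ'.shift (φ w) := fun w => fock_ext fun v => by
    obtain ⟨v, rfl⟩ := φ.surjective v
    change U (Λ.shift w (U.symm (Λ'.fockBasis (φ v)))) = _
    rw [← hU, U.symm_apply_apply, shift_apply_basis, hU, hU, shift_apply_basis, map_mul]
  have hmap : Λ.toeplitz.map E.toAlgHom =
      Λ'.toeplitz := by
    have h1 : (Algebra.adjoin ℂ (Set.range Λ.shift)).map
        E.toAlgHom =
          Algebra.adjoin ℂ (Set.range Λ'.shift) := by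
      rw [AlgHom.map_adjoin, ← Set.range_comp, ← φ.surjective.range_comp Λ'.shift]
      exact congrArg _ (congrArg _ (funext hshift))
    apply SetLike.coe_injective
    have h2 := congrArg (fun S : Subalgebra ℂ _ => closure (S : Set (Λ'.Fock →L[ℂ] Λ'.Fock))) h1
    simp only [Subalgebra.coe_map] at h2
    exact ((IsometryEquiv.mk E.toEquiv hiso).toHomeomorph.image_closure _).trans h2
  refine ⟨(E.subalgebraMap Λ.toeplitz).trans (Subalgebra.equivOfEq _ _ hmap), ?_⟩
  exact Isometry.of_dist_eq fun a b => hiso.dist_eq a.1 b.1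

/-! ### The Gelfand space -/

/-- The cone of the points `(z, w)` of `ℂⁿ × ℂᵐ` that satisfy `z_i w_j = z_{i'} w_{j'}` for all
`(i', j') = θ (i, j)`.  Points are written as functions on the edges. -/
def relVariety {n m : ℕ} (θ : Equiv.Perm (Fin n × Fin m)) : Set (Fin n ⊕ Fin m → ℂ) :=
  {p | ∀ c, p (.inl c.1) * p (.inr c.2) = p (.inl (θ c).1) * p (.inr (θ c).2)}

/-- The cone `(ℂⁿ × 0) ∪ (0 × ℂᵐ) ∪ (E_n × E_m)`. -/
def minimalCone (n m : ℕ) : Set (Fin n ⊕ Fin m → ℂ) :=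
  {p | (∀ j, p (.inr j) = 0) ∨ (∀ i, p (.inl i) = 0) ∨
    ((∀ i i', p (.inl i) = p (.inl i')) ∧ ∀ j j', p (.inr j) = p (.inr j'))}

theorem smul_mem_relVariety {n m : ℕ} {θ : Equiv.Perm (Fin n × Fin m)} {p : Fin n ⊕ Fin m → ℂ}
    (hp : p ∈ relVariety θ) (r : ℂ) : r • p ∈ relVariety θ := fun c => by
  have := hp c
  simp only [Pi.smul_apply, smul_eq_mul]
  linear_combination r ^ 2 * this

/-- The words of length `k` contribute the `k`-th power of `∑ a, c a`. -/
theorem summable_list_prod {α : Type*} [Fintype α] (c : α → ℝ) (h0 : ∀ a, 0 ≤ c a)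
    (h1 : ∑ a, c a < 1) : Summable fun v : List α => (v.map c).prod := by
  classical
  rw [← (List.equivSigmaTuple (α := α)).symm.summable_iff, summable_sigma_of_nonneg]
  · refine ⟨fun k => Summable.of_finite, ?_⟩
    have h : ∀ k, ∑' f : Fin k → α, ((fun v : List α => (v.map c).prod) ∘
        (List.equivSigmaTuple (α := α)).symm) ⟨k, f⟩ = (∑ a, c a) ^ k := fun k => by
      rw [tsum_fintype]
      have h2 : ∀ f : Fin k → α, ((fun v : List α => (v.map c).prod) ∘
          (List.equivSigmaTuple (α := α)).symm) ⟨k, f⟩ = ∏ i, c (f i) := fun f => by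
        change ((List.ofFn f).map c).prod = _
        rw [List.map_ofFn, List.prod_ofFn]
        rfl
      simp only [h2]
      rw [← Fintype.sum_pow]
    simp only [h]
    exact summable_geometric_of_lt_one (Finset.sum_nonneg fun a _ => h0 a) h1
  · intro x
    refine List.prod_nonneg ?_
    intro a ha
    obtain ⟨b, -, rfl⟩ := List.mem_map.1 ha
    exact h0 b

section Weight

variable {n m : ℕ} {θ : Equiv.Perm (Fin n × Fin m)} {p : Fin n ⊕ Fin m → ℂ}

theorem prod_passOne (hp : p ∈ relVariety θ) (j : Fin m) (v : List (Fin n)) :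
    ((passOne θ j v).1.map fun i => p (.inl i)).prod * p (.inr (passOne θ j v).2) =
      p (.inr j) * (v.map fun i => p (.inl i)).prod := by
  induction v generalizing j with
  | nil => simp [passOne]
  | cons i v ih =>
    have h := hp (θ.symm (i, j))
    rw [Equiv.apply_symm_apply] at h
    simp only [passOne, List.map_cons, List.prod_cons, mul_assoc, ih]
    linear_combination (v.map fun i => p (.inl i)).prod * h

theorem prod_pass (hp : p ∈ relVariety θ) (u : List (Fin m)) (v : List (Fin n)) :
    ((pass θ u v).1.map fun i => p (.inl i)).prod * ((pass θ u v).2.map fun j => p (.inr j)).prod =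
      (u.map fun j => p (.inr j)).prod * (v.map fun i => p (.inl i)).prod := by
  induction u with
  | nil => simp [pass]
  | cons j u ih =>
    have h := prod_passOne hp j (pass θ u v).1
    simp only [pass, List.map_cons, List.prod_cons]
    linear_combination ((pass θ u v).2.map fun j => p (.inr j)).prod * h + p (.inr j) * ih

/-- The points of `relVariety θ` are the multiplicative functions on the paths. -/
theorem Labelling.Relations.exists_monoidHom {Λ : TwoGraph.{u}} {l : Λ.Labelling n m}
    (hl : l.Relations θ) (hp : p ∈ relVariety θ) (h1 : ∑ i, ‖p (.inl i)‖ ^ 2 < 1)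
    (h2 : ∑ j, ‖p (.inr j)‖ ^ 2 < 1) :
    ∃ χ : Λ.Path →* ℂ, (∀ g, χ (l.edge g) = p g) ∧ Summable fun x => ‖χ x‖ ^ 2 := by
  obtain ⟨φ, hφ, -⟩ := hl.exists_equiv.{u, 0}
  let χ : NormalForm.{0} θ →* ℂ :=
    { toFun := fun x => (x.e.map fun i => p (.inl i)).prod * (x.f.map fun j => p (.inr j)).prod
      map_one' := by simp [NormalForm.one_def]
      map_mul' := fun x y => by
        have h := prod_pass hp x.f y.e
        simp only [NormalForm.mul_def, List.map_append, List.prod_append]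
        linear_combination (x.e.map fun i => p (.inl i)).prod *
          (y.f.map fun j => p (.inr j)).prod * h }
  refine ⟨χ.comp φ.symm.toMonoidHom, fun g => ?_, ?_⟩
  · have h3 : ∀ x : NormalForm.{0} θ, χ (φ.symm (φ x)) = χ x := fun x =>
      congrArg χ (φ.symm_apply_apply x)
    change χ (φ.symm (l.edge g)) = _
    cases g with
    | inl i =>
      have h4 := hφ ⟨[i], []⟩
      simp only [Labelling.ePath, Labelling.fPath, List.map_cons, List.map_nil, List.prod_cons,
        List.prod_nil, mul_one] at h4
      change χ (φ.symm (l.e i)) = _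
      rw [← h4, h3]
      simp [χ]
    | inr j =>
      have h4 := hφ ⟨[], [j]⟩
      simp only [Labelling.ePath, Labelling.fPath, List.map_cons, List.map_nil, List.prod_cons,
        List.prod_nil, mul_one, one_mul] at h4
      change χ (φ.symm (l.f j)) = _
      rw [← h4, h3]
      simp [χ]
  · let ψ : List (Fin n) × List (Fin m) ≃ Λ.Path :=
      (⟨fun x => ⟨x.1, x.2⟩, fun x => (x.e, x.f), fun _ => rfl, fun _ => rfl⟩ :
        List (Fin n) × List (Fin m) ≃ NormalForm.{0} θ).trans φ.toEquiv
    rw [← ψ.summable_iff]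
    have h3 := (summable_list_prod (fun i => ‖p (.inl i)‖ ^ 2) (fun i => by positivity)
      h1).mul_of_nonneg (summable_list_prod (fun j => ‖p (.inr j)‖ ^ 2) (fun j => by positivity) h2)
      (fun v => List.prod_nonneg (by simp only [List.mem_map]; rintro _ ⟨a, -, rfl⟩; positivity))
      (fun v => List.prod_nonneg (by simp only [List.mem_map]; rintro _ ⟨a, -, rfl⟩; positivity))
    refine h3.congr fun x => ?_
    have h4 : ∀ {α : Type} (q : α → ℂ) (v : List α),
        (v.map fun i => ‖q i‖ ^ 2).prod = ‖(v.map q).prod‖ ^ 2 := fun q v => by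
      induction v with
      | nil => simp
      | cons a v ih => simp [ih, mul_pow]
    have h5 : ((χ.comp φ.symm.toMonoidHom) (ψ x)) = χ ⟨x.1, x.2⟩ :=
      congrArg χ (φ.symm_apply_apply (⟨x.1, x.2⟩ : NormalForm.{0} θ))
    rw [Function.comp_apply, h5, h4, h4, ← mul_pow, ← norm_mul]
    rfl

end Weight

section Gelfand

open scoped InnerProductSpace

variable {Λ : TwoGraph.{u}} {n m : ℕ} {l : Λ.Labelling n m} {θ : Equiv.Perm (Fin n × Fin m)}

instance completeSpace_toeplitz : CompleteSpace Λ.toeplitz :=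
  (Subalgebra.isClosed_topologicalClosure _).completeSpace_coe

/-- A square summable multiplicative function `χ` on the paths defines a character, the vector
functional of the joint eigenvector `∑ conj (χ x) ξ_x` of the adjoints of the shifts. -/
theorem exists_character (χ : Λ.Path →* ℂ) (hχ : Summable fun x => ‖χ x‖ ^ 2) :
    ∃ ρ : WeakDual.characterSpace ℂ Λ.toeplitz, ∀ x, ρ (Λ.toeplitzShift x) = χ x := by
  have hmem : Memℓp (fun x => (starRingEnd ℂ) (χ x)) 2 := memℓp_gen (by simpa using hχ)
  let ν : Λ.Fock := ⟨fun x => (starRingEnd ℂ) (χ x), hmem⟩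
  have hν : ∀ x, vacuumFunctional ν (Λ.toeplitzShift x) = χ x := fun x => by
    rw [vacuumFunctional_toeplitzShift, ← inner_conj_symm, ← HilbertBasis.repr_apply_apply]
    exact Complex.conj_conj _
  have hmul : ∀ a b, vacuumFunctional ν (a * b) = vacuumFunctional ν a * vacuumFunctional ν b := by
    intro a b
    have := map_mul_eq_sum (Finset.univ : Finset Unit) (vacuumFunctional ν)
      (fun _ => vacuumFunctional ν) (fun _ => vacuumFunctional ν)
      (fun w v => by simp [hν]) a b
    simpa using this
  refine ⟨⟨StrongDual.toWeakDual (vacuumFunctional ν), fun h => ?_, hmul⟩, hν⟩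
  have h1 := hν 1
  rw [map_one] at h1
  have h2 := congrArg (fun F : WeakDual ℂ Λ.toeplitz => F (Λ.toeplitzShift 1)) h
  exact one_ne_zero (h1.symm.trans h2)

/-- The values of a character at the shifts by paths of equal degree form a vector `z` of norm at
most one: evaluate the character at `∑ conj z_i L_i`, an element of norm at most `‖z‖`. -/
theorem norm_gelfandCoord_le (ρ : WeakDual.characterSpace ℂ Λ.toeplitz) {ι : Type*} [Fintype ι]
    (g : ι → Λ.Path) (hg : Function.Injective g) (hd : ∀ i j, Λ.d (g i) = Λ.d (g j)) :
    ‖(WithLp.toLp 2 fun i => ρ (Λ.toeplitzShift (g i)) : EuclideanSpace ℂ ι)‖ ≤ 1 := by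
  set S := ∑ i, ‖ρ (Λ.toeplitzShift (g i))‖ ^ 2 with hS
  have h1 := norm_sum_smul_toeplitzShift_sq_le g hg hd
    fun i => (starRingEnd ℂ) (ρ (Λ.toeplitzShift (g i)))
  set a := ∑ i, (starRingEnd ℂ) (ρ (Λ.toeplitzShift (g i))) • Λ.toeplitzShift (g i) with ha
  have h2 : ρ a = (S : ℂ) := by
    rw [ha, map_sum, hS]
    push_cast
    refine Finset.sum_congr rfl fun i _ => ?_
    rw [map_smul, smul_eq_mul, Complex.conj_mul']
  have h3 : ‖ρ a‖ ≤ ‖a‖ := by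
    have h4 := (WeakDual.toStrongDual (ρ : WeakDual ℂ Λ.toeplitz)).le_opNorm a
    have h5 := WeakDual.CharacterSpace.norm_le_norm_one ρ
    have h6 : ‖(1 : Λ.toeplitz)‖ ≤ 1 := ContinuousLinearMap.norm_id_le
    refine h4.trans ?_
    exact mul_le_of_le_one_left (norm_nonneg _) (h5.trans h6)
  have hS0 : 0 ≤ S := Finset.sum_nonneg fun i _ => by positivity
  simp only [RCLike.norm_conj, ← hS] at h1
  rw [h2, Complex.norm_real, Real.norm_of_nonneg hS0] at h3
  have h4 : S ≤ 1 := by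
    by_contra h
    push Not at h
    nlinarith
  rw [EuclideanSpace.norm_eq, Real.sqrt_le_iff, one_pow]
  exact ⟨zero_le_one, h4⟩

/-- The coordinates of a point of `ℂⁿ × ℂᵐ`, as a function on the edges. -/
def edgeCoord (p : EuclideanSpace ℂ (Fin n) × EuclideanSpace ℂ (Fin m)) : Fin n ⊕ Fin m → ℂ :=
  Sum.elim (fun i => p.1 i) (fun j => p.2 j)

theorem edgeCoord_gelfandCoord (ρ : WeakDual.characterSpace ℂ Λ.toeplitz) (g : Fin n ⊕ Fin m) :
    edgeCoord (Λ.gelfandCoord l ρ) g = ρ (Λ.toeplitzShift (l.edge g)) := by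
  cases g <;> rfl

/-- The Gelfand space is the part of `relVariety θ` in the product of the closed unit balls. -/
theorem Labelling.Relations.range_gelfandCoord (hl : l.Relations θ) :
    Set.range (Λ.gelfandCoord l) = {p | ‖p.1‖ ≤ 1 ∧ ‖p.2‖ ≤ 1 ∧ edgeCoord p ∈ relVariety θ} := by
  apply Set.Subset.antisymm
  · rintro _ ⟨ρ, rfl⟩
    refine ⟨norm_gelfandCoord_le ρ _ (fun i j h => l.e_inj.1 h) fun i j => by
      rw [l.d_e, l.d_e], norm_gelfandCoord_le ρ _ (fun i j h => l.f_inj.1 h) fun i j => by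
      rw [l.d_f, l.d_f], fun c => ?_⟩
    simp only [edgeCoord_gelfandCoord, ← map_mul, ← toeplitzShift_mul]
    have h := hl c.1 c.2
    change ρ (Λ.toeplitzShift ((l.e c.1 : Λ.Path) * (l.f c.2 : Λ.Path))) = _
    rw [h, toeplitzShift_mul, map_mul, mul_comm]
    rw [toeplitzShift_mul, map_mul]
    rfl
  · rintro p ⟨h1, h2, h3⟩
    have hc : IsCompact (Set.range (Λ.gelfandCoord l)) := by
      refine isCompact_range ?_
      have h : ∀ a : Λ.toeplitz, Continuous fun ρ : WeakDual.characterSpace ℂ Λ.toeplitz => ρ a :=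
        fun a => (WeakDual.eval_continuous a).comp continuous_subtype_val
      refine Continuous.prodMk ?_ ?_
      · exact (PiLp.continuous_toLp 2 _).comp (continuous_pi fun i => h _)
      · exact (PiLp.continuous_toLp 2 _).comp (continuous_pi fun i => h _)
    -- the points `r p` with `0 < r < 1` are interior, and `p` is their limit
    have hin : ∀ r ∈ Set.Ioo (0 : ℝ) 1, (r : ℂ) • p ∈ Set.range (Λ.gelfandCoord l) := by
      intro r hr
      have hlt : ∀ {ι : Type} [Fintype ι] (q : EuclideanSpace ℂ ι), ‖q‖ ≤ 1 →
          ∑ i, ‖(r : ℂ) * q i‖ ^ 2 < 1 := fun {ι} _ q hq => by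
        simp only [norm_mul, mul_pow, ← Finset.mul_sum]
        rw [← EuclideanSpace.norm_sq_eq, Complex.norm_real, Real.norm_of_nonneg hr.1.le]
        have := norm_nonneg q
        have : ‖q‖ ^ 2 ≤ 1 := by nlinarith
        nlinarith [hr.1, hr.2]
      obtain ⟨χ, hχ, hs⟩ := hl.exists_monoidHom (smul_mem_relVariety h3 (r : ℂ))
        (hlt p.1 h1) (hlt p.2 h2)
      obtain ⟨ρ, hρ⟩ := exists_character χ hs
      refine ⟨ρ, Prod.ext ?_ ?_⟩
      · ext i
        exact (hρ _).trans (hχ (.inl i))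
      · ext j
        exact (hρ _).trans (hχ (.inr j))
    have hlim : Filter.Tendsto (fun r : ℝ => (r : ℂ) • p) (nhdsWithin 1 (Set.Iio 1)) (nhds p) := by
      have h : Continuous fun r : ℝ => (r : ℂ) • p := by fun_prop
      have := (h.tendsto 1).mono_left (nhdsWithin_le_nhds (s := Set.Iio 1))
      simpa using this
    exact hc.isClosed.mem_of_tendsto hlim
      (Filter.mem_of_superset (Ioo_mem_nhdsLT one_pos) hin)

theorem edgeCoord_mem_minimalCone {p : EuclideanSpace ℂ (Fin n) × EuclideanSpace ℂ (Fin m)} :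
    edgeCoord p ∈ minimalCone n m ↔
      (p.2 = 0 ∨ p.1 = 0 ∨ ((∀ i i', p.1 i = p.1 i') ∧ ∀ j j', p.2 j = p.2 j')) := by
  refine or_congr ?_ (or_congr ?_ Iff.rfl)
  · exact ⟨fun h => PiLp.ext h, fun h j => congrArg (fun q => q j) h⟩
  · exact ⟨fun h => PiLp.ext h, fun h j => congrArg (fun q => q j) h⟩

theorem Labelling.Relations.range_gelfandCoord_eq_minimal (hl : l.Relations θ)
    (h : relVariety θ = minimalCone n m) : Set.range (Λ.gelfandCoord l) = minimalGelfand n m := by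
  rw [hl.range_gelfandCoord, h]
  simp only [edgeCoord_mem_minimalCone]
  rfl

theorem Labelling.Relations.relVariety_eq_minimalCone (hl : l.Relations θ)
    (h : Set.range (Λ.gelfandCoord l) = minimalGelfand n m) :
    relVariety θ = minimalCone n m := by
  ext p
  -- both cones are determined by their points in the product of the balls
  obtain ⟨r, hr, h1, h2⟩ : ∃ r : ℂ, r ≠ 0 ∧
      ‖(WithLp.toLp 2 fun i => r * p (.inl i) : EuclideanSpace ℂ (Fin n))‖ ≤ 1 ∧
      ‖(WithLp.toLp 2 fun j => r * p (.inr j) : EuclideanSpace ℂ (Fin m))‖ ≤ 1 := by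
    set P : EuclideanSpace ℂ (Fin n) := WithLp.toLp 2 fun i => p (.inl i) with hP
    set Q : EuclideanSpace ℂ (Fin m) := WithLp.toLp 2 fun i => p (.inr i) with hQ
    have hpos : 0 < 1 + ‖P‖ + ‖Q‖ := by positivity
    have hr : ‖((1 + ‖P‖ + ‖Q‖ : ℝ) : ℂ)⁻¹‖ = (1 + ‖P‖ + ‖Q‖)⁻¹ := by
      rw [norm_inv, Complex.norm_real, Real.norm_of_nonneg hpos.le]
    refine ⟨((1 + ‖P‖ + ‖Q‖ : ℝ) : ℂ)⁻¹, inv_ne_zero (by exact_mod_cast hpos.ne'), ?_, ?_⟩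
    · change ‖((1 + ‖P‖ + ‖Q‖ : ℝ) : ℂ)⁻¹ • P‖ ≤ 1
      rw [norm_smul, hr, inv_mul_le_one₀ hpos]
      linarith [norm_nonneg Q]
    · change ‖((1 + ‖P‖ + ‖Q‖ : ℝ) : ℂ)⁻¹ • Q‖ ≤ 1
      rw [norm_smul, hr, inv_mul_le_one₀ hpos]
      linarith [norm_nonneg P]
  rw [hl.range_gelfandCoord] at h
  have h3 := Set.ext_iff.1 h (WithLp.toLp 2 fun i => r * p (.inl i),
    WithLp.toLp 2 fun j => r * p (.inr j))
  have h4 : edgeCoord (WithLp.toLp 2 fun i => r * p (.inl i),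
      WithLp.toLp 2 fun j => r * p (.inr j)) = r • p := by
    ext g
    cases g <;> rfl
  have h5 : r • p ∈ relVariety θ ↔ p ∈ relVariety θ :=
    ⟨fun h => by simpa [smul_smul, hr] using smul_mem_relVariety h r⁻¹,
      fun h => smul_mem_relVariety h r⟩
  have h6 : r • p ∈ minimalCone n m ↔ p ∈ minimalCone n m := by
    simp [minimalCone, hr]
  simp only [minimalGelfand, Set.mem_ofPred_eq, ← edgeCoord_mem_minimalCone, h4, h5, h6] at h3
  exact ⟨fun h => (h3.1 ⟨h1, h2, h⟩).2.2, fun h => (h3.2 ⟨h1, h2, h⟩).2.2⟩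

end Gelfand

/-- For relations of cyclic type all products `z_i w_j` are equal. -/
theorem relVariety_eq_minimalCone_of_isCycle {n m : ℕ} {θ : Equiv.Perm (Fin n × Fin m)}
    (hc : θ.IsCycle) (hs : θ.support = Finset.univ) : relVariety θ = minimalCone n m := by
  ext p
  constructor
  · intro hp
    have hpow : ∀ (k : ℕ) c, p (.inl c.1) * p (.inr c.2) =
        p (.inl ((θ ^ k) c).1) * p (.inr ((θ ^ k) c).2) := by
      intro k c
      induction k with
      | zero => rfl
      | succ k ih =>
        rw [ih, pow_succ', Equiv.Perm.mul_apply]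
        exact hp _
    have hall : ∀ i j i' j', p (.inl i) * p (.inr j) = p (.inl i') * p (.inr j') := by
      intro i j i' j'
      have hne : ∀ c, θ c ≠ c := fun c => Equiv.Perm.mem_support.1 (by simp [hs])
      obtain ⟨k, hk⟩ := hc.exists_pow_eq (hne (i, j)) (hne (i', j'))
      have := hpow k (i, j)
      rwa [hk] at this
    by_cases hw : ∀ j, p (.inr j) = 0
    · exact Or.inl hw
    by_cases hz : ∀ i, p (.inl i) = 0
    · exact Or.inr (Or.inl hz)
    push Not at hw hz
    obtain ⟨j₀, hj⟩ := hw
    obtain ⟨i₀, hi⟩ := hz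
    exact Or.inr (Or.inr ⟨fun i i' => mul_right_cancel₀ hj (hall i j₀ i' j₀),
      fun j j' => mul_left_cancel₀ hi (hall i₀ j i₀ j')⟩)
  · rintro (h | h | ⟨h, h'⟩) c
    · simp [h]
    · simp [h]
    · rw [h c.1 (θ c).1, h' c.2 (θ c).2]

/-! ### Linear maps that preserve the minimal cone -/

section LinearAlgebra

open Matrix

variable {n m : ℕ}

/-- An invertible linear map of `ℂⁿ × ℂᵐ`, `2 ≤ n < m`, that maps the minimal cone into itself
permutes its three components, and for reasons of dimension it fixes each of them. -/
theorem blockDiagonal_of_minimalCone (hn : 2 ≤ n) (hnm : n < m)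
    {T T' : Matrix (Fin n ⊕ Fin m) (Fin n ⊕ Fin m) ℂ} (hT : T' * T = 1)
    (hcone : ∀ p ∈ minimalCone n m, T *ᵥ p ∈ minimalCone n m) :
    (∀ i l, T (.inl i) (.inr l) = 0) ∧ (∀ j k, T (.inr j) (.inl k) = 0) ∧
      (∃ α, ∀ i, ∑ k, T (.inl i) (.inl k) = α) ∧ ∃ β, ∀ j, ∑ l, T (.inr j) (.inr l) = β := by
  have : NeZero n := ⟨by omega⟩
  have : NeZero m := ⟨by omega⟩
  have hT2 : T * T' = 1 := mul_eq_one_comm.1 hT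
  have hinj : ∀ p, T *ᵥ p = 0 → p = 0 := fun p hp => by
    rw [← Matrix.one_mulVec p, ← hT, ← Matrix.mulVec_mulVec, hp, Matrix.mulVec_zero]
  have hsurj : ∀ q, ∃ p, T *ᵥ p = q := fun q =>
    ⟨T' *ᵥ q, by rw [Matrix.mulVec_mulVec, hT2, Matrix.one_mulVec]⟩
  let K : Fin 3 → Submodule ℂ (Fin n ⊕ Fin m → ℂ) :=
    ![{ carrier := {p | ∀ j, p (.inr j) = 0}
        add_mem' := fun h h' j => by simp [h j, h' j]
        zero_mem' := fun j => rfl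
        smul_mem' := fun c p h j => by simp [h j] },
      { carrier := {p | ∀ i, p (.inl i) = 0}
        add_mem' := fun h h' j => by simp [h j, h' j]
        zero_mem' := fun j => rfl
        smul_mem' := fun c p h j => by simp [h j] },
      { carrier := {p | (∀ i i', p (.inl i) = p (.inl i')) ∧ ∀ j j', p (.inr j) = p (.inr j')}
        add_mem' := fun h h' => ⟨fun i i' => by simp [h.1 i i', h'.1 i i'],
          fun j j' => by simp [h.2 j j', h'.2 j j']⟩
        zero_mem' := ⟨fun i i' => rfl, fun j j' => rfl⟩
        smul_mem' := fun c p h => ⟨fun i i' => by simp [h.1 i i'],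
          fun j j' => by simp [h.2 j j']⟩ }]
  have hK : ∀ p, p ∈ minimalCone n m ↔ ∃ s, p ∈ K s := fun p => by
    rw [Fin.exists_fin_succ, Fin.exists_fin_two]
    rfl
  -- a linear subspace in a finite union of subspaces lies in one of them
  have hcover : ∀ r, ∃ s, ∀ p ∈ K r, T *ᵥ p ∈ K s := by
    intro r
    let P : Fin 3 → Submodule ℂ (K r) := fun s => (K s).comap (T.mulVecLin ∘ₗ (K r).subtype)
    obtain ⟨s, hs⟩ := Subspace.exists_eq_top_of_iUnion_eq_univ (p := P) (by
      refine Set.eq_univ_of_forall fun p => ?_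
      obtain ⟨s, hs⟩ := (hK _).1 (hcone p ((hK _).2 ⟨r, p.2⟩))
      exact Set.mem_iUnion.2 ⟨s, hs⟩)
    refine ⟨s, fun p hp => ?_⟩
    have : (⟨p, hp⟩ : K r) ∈ P s := by rw [hs]; trivial
    exact this
  have hsplit : ∀ p : Fin n ⊕ Fin m → ℂ, ∃ q ∈ K 0, ∃ q' ∈ K 1, p = q + q' := fun p =>
    ⟨Sum.elim (fun i => p (.inl i)) 0, fun j => rfl, Sum.elim 0 (fun j => p (.inr j)),
      fun i => rfl, by ext g; cases g <;> simp⟩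
  let ι : (Fin m → ℂ) →ₗ[ℂ] (Fin n ⊕ Fin m → ℂ) :=
    { toFun := fun w => Sum.elim 0 w
      map_add' := fun w w' => by ext g; cases g <;> simp
      map_smul' := fun c w => by ext g; cases g <;> simp }
  have hι : ∀ w, ι w ∈ K 1 := fun w i => rfl
  have hι0 : ∀ w, ι w = 0 → w = 0 := fun w hw => funext fun j => congrFun hw (.inr j)
  -- `T` preserves `0 × ℂᵐ`, as the other two components have smaller dimension
  have h1 : ∀ p ∈ K 1, T *ᵥ p ∈ K 1 := by
    obtain ⟨s, hs⟩ := hcover 1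
    fin_cases s
    · exfalso
      have h := LinearMap.finrank_le_finrank_of_injective
        (f := (LinearMap.funLeft ℂ ℂ Sum.inl) ∘ₗ T.mulVecLin ∘ₗ ι)
        ((injective_iff_map_eq_zero _).2 fun w hw => hι0 w <| hinj _ <| by
          ext g
          cases g with
          | inl i => exact congrFun hw i
          | inr j => exact hs _ (hι w) j)
      simp at h
      omega
    · exact hs
    · exfalso
      have h := LinearMap.finrank_le_finrank_of_injective
        (f := (LinearMap.funLeft ℂ ℂ
          (![.inl 0, .inr 0] : Fin 2 → Fin n ⊕ Fin m)) ∘ₗ T.mulVecLin ∘ₗ ι)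
        ((injective_iff_map_eq_zero _).2 fun w hw => hι0 w <| hinj _ <| by
          obtain ⟨h2, h3⟩ := hs _ (hι w)
          ext g
          cases g with
          | inl i => exact (h2 i 0).trans (congrFun hw 0)
          | inr j => exact (h3 j 0).trans (congrFun hw 1))
      simp at h
      omega
  -- `T` preserves `ℂⁿ × 0`, as otherwise it would not be surjective
  have h0 : ∀ p ∈ K 0, T *ᵥ p ∈ K 0 := by
    obtain ⟨s, hs⟩ := hcover 0
    fin_cases s
    · exact hs
    · exfalso
      obtain ⟨p, hp⟩ := hsurj (Pi.single (.inl 0) 1)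
      obtain ⟨q, hq, q', hq', rfl⟩ := hsplit p
      have h2 : T *ᵥ q ∈ K 1 := hs q hq
      have h3 := congrFun hp (.inl 0)
      rw [Matrix.mulVec_add, Pi.add_apply, h2 0, h1 q' hq' 0] at h3
      simp at h3
    · exfalso
      obtain ⟨p, hp⟩ := hsurj (Pi.single (.inl 0) 1)
      obtain ⟨q, hq, q', hq', rfl⟩ := hsplit p
      have h2 : T *ᵥ q ∈ K 2 := hs q hq
      have h3 := congrFun hp (.inl 0)
      have h4 := congrFun hp (.inl ⟨1, by omega⟩)
      have hne : (⟨1, by omega⟩ : Fin n) ≠ 0 := fun h => by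
        simpa using congrArg Fin.val h
      rw [Matrix.mulVec_add, Pi.add_apply, h1 q' hq', h2.1 _ 0] at h4
      rw [Matrix.mulVec_add, Pi.add_apply, h1 q' hq', h4] at h3
      simp [hne] at h3
  have hone : T *ᵥ 1 ∈ K 2 := by
    obtain ⟨s, hs⟩ := hcover 2
    have h2 := hs 1 ⟨fun i i' => rfl, fun j j' => rfl⟩
    obtain ⟨q, hq, q', hq', hqq⟩ := hsplit 1
    fin_cases s
    · exfalso
      have h3 : q' = 0 := hinj _ <| by
        ext g
        cases g with
        | inl i => exact h1 q' hq' i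
        | inr j =>
          have h4 : (T *ᵥ 1) (.inr j) = 0 := h2 j
          rw [hqq, Matrix.mulVec_add, Pi.add_apply, h0 q hq j, zero_add] at h4
          exact h4
      have h4 := congrFun hqq (.inr 0)
      rw [h3, Pi.add_apply, hq 0] at h4
      simp at h4
    · exfalso
      have h3 : q = 0 := hinj _ <| by
        ext g
        cases g with
        | inr j => exact h0 q hq j
        | inl i =>
          have h4 : (T *ᵥ 1) (.inl i) = 0 := h2 i
          rw [hqq, Matrix.mulVec_add, Pi.add_apply, h1 q' hq' i, add_zero] at h4
          exact h4
      have h4 := congrFun hqq (.inl 0)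
      rw [h3, Pi.add_apply, hq' 0] at h4
      simp at h4
    · exact h2
  have hlr : ∀ i l, T (.inl i) (.inr l) = 0 := fun i l => by
    have h2 : T *ᵥ Pi.single (.inr l) 1 ∈ K 1 := h1 _ fun i => by simp
    simpa using h2 i
  have hrl : ∀ j k, T (.inr j) (.inl k) = 0 := fun j k => by
    have h2 : T *ᵥ Pi.single (.inl k) 1 ∈ K 0 := h0 _ fun i => by simp
    simpa using h2 j
  have hsum : ∀ g, (T *ᵥ 1) g = ∑ k, T g (.inl k) + ∑ l, T g (.inr l) := fun g => by
    simp [Matrix.mulVec, dotProduct]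
  refine ⟨hlr, hrl, ⟨∑ k, T (.inl 0) (.inl k), fun i => ?_⟩,
    ⟨∑ l, T (.inr 0) (.inr l), fun j => ?_⟩⟩
  · have h2 : (T *ᵥ 1) (.inl i) = (T *ᵥ 1) (.inl 0) := hone.1 i 0
    rw [hsum, hsum] at h2
    simpa [hlr] using h2
  · have h2 : (T *ᵥ 1) (.inr j) = (T *ᵥ 1) (.inr 0) := hone.2 j 0
    rw [hsum, hsum] at h2
    simpa [hrl] using h2

/-- A matrix is unitary if it and its inverse are contractions on row vectors. -/
theorem mul_conjTranspose_eq_one_of_contractive {ι : Type*} [Fintype ι] [DecidableEq ι]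
    {A A' : Matrix ι ι ℂ} (h : A * A' = 1)
    (hA : ∀ c : ι → ℂ, ∑ k, ‖(c ᵥ* A) k‖ ^ 2 ≤ ∑ i, ‖c i‖ ^ 2)
    (hA' : ∀ c : ι → ℂ, ∑ k, ‖(c ᵥ* A') k‖ ^ 2 ≤ ∑ i, ‖c i‖ ^ 2) : A * Aᴴ = 1 := by
  have hnorm : ∀ c : ι → ℂ, ∑ k, ‖(c ᵥ* A) k‖ ^ 2 = ∑ i, ‖c i‖ ^ 2 := fun c => by
    refine le_antisymm (hA c) ?_
    have h1 := hA' (c ᵥ* A)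
    rwa [Matrix.vecMul_vecMul, h, Matrix.vecMul_one] at h1
  let f : EuclideanSpace ℂ ι →ₗᵢ[ℂ] EuclideanSpace ℂ ι :=
    { toFun := fun c => WithLp.toLp 2 (c.ofLp ᵥ* A)
      map_add' := fun c c' => by ext; simp [Matrix.add_vecMul]
      map_smul' := fun r c => by ext; simp [Matrix.smul_vecMul]
      norm_map' := fun c => by
        rw [EuclideanSpace.norm_eq, EuclideanSpace.norm_eq]
        exact congrArg Real.sqrt (hnorm c.ofLp) }
  ext i j
  have h1 := f.inner_map_map (EuclideanSpace.single j 1) (EuclideanSpace.single i 1)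
  simp only [f, LinearIsometry.coe_mk, LinearMap.coe_mk, AddHom.coe_mk, PiLp.inner_apply,
    RCLike.inner_apply] at h1
  simpa [Matrix.mul_apply, Matrix.one_apply, eq_comm (a := j)] using h1

/-- A unitary matrix with constant row sums `α` has constant column sums, also equal to `α`. -/
theorem commute_ones_of_rowSums {ι : Type*} [Fintype ι] [DecidableEq ι] [Nonempty ι]
    {A : Matrix ι ι ℂ} (hA : A * Aᴴ = 1) {α : ℂ} (hα : ∀ i, ∑ k, A i k = α) :
    Commute A (Matrix.of fun _ _ => 1) := by
  have hA2 : Aᴴ * A = 1 := mul_eq_one_comm.1 hA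
  have h1 : A *ᵥ 1 = α • 1 := by
    ext i
    simpa [Matrix.mulVec, dotProduct] using hα i
  have h2 : α • (Aᴴ *ᵥ 1) = 1 := by
    rw [← Matrix.mulVec_smul, ← h1, Matrix.mulVec_mulVec, hA2, Matrix.one_mulVec]
  have hα0 : α ≠ 0 := by
    rintro rfl
    have := congrFun h2 (Classical.arbitrary ι)
    simp at this
  have h3 : ∀ k, ∑ i, A i k = (starRingEnd ℂ) α⁻¹ := fun k => by
    have h4 := congrFun h2 k
    simp only [Pi.smul_apply, Matrix.mulVec, dotProduct, Matrix.conjTranspose_apply, Pi.one_apply,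
      mul_one, smul_eq_mul] at h4
    have h5 : ∑ i, star (A i k) = α⁻¹ := by
      field_simp
      rwa [mul_comm]
    rw [← h5, map_sum]
    simp
  have h4 : α = (starRingEnd ℂ) α⁻¹ := by
    have h5 := Finset.sum_comm (s := Finset.univ) (t := Finset.univ) (f := fun i k => A i k)
    simp only [hα, h3, Finset.sum_const, nsmul_eq_mul] at h5
    exact mul_left_cancel₀ (by simp) h5
  ext i k
  simp [Matrix.mul_apply, hα, h3, ← h4]

end LinearAlgebra

/-! ### Rigidity of isometric isomorphisms -/

section Rigidity

open Matrix

variable {Λ₁ : TwoGraph.{u}} {Λ₂ : TwoGraph.{v}} {n m : ℕ}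

/-- The linear parts at the edges of the images of the generators: the entry at `(g, h)` is the
coefficient of `φ (L_g)` at the edge `h`. -/
noncomputable def linearPart (l₁ : Λ₁.Labelling n m) (l₂ : Λ₂.Labelling n m)
    (φ : Λ₁.toeplitz → Λ₂.toeplitz) : Matrix (Fin n ⊕ Fin m) (Fin n ⊕ Fin m) ℂ :=
  Matrix.of fun g h => coeff (l₂.edge h) (φ (Λ₁.toeplitzShift (l₁.edge g)))

theorem coeff_one_one {Λ : TwoGraph.{u}} : coeff 1 (1 : Λ.toeplitz) = 1 := by
  rw [← toeplitzShift_one, coeff_toeplitzShift, if_pos rfl]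

variable {l₁ : Λ₁.Labelling n m} {l₂ : Λ₂.Labelling n m}

/-- The character `coeff 1` is the only one at which every function on the edges extends to a
point derivation, provided that the cone `relVariety θ` is minimal.  Since an isomorphism
transports point derivations, it preserves this character. -/
theorem coeff_one_apply_edge {θ : Equiv.Perm (Fin n × Fin m)} (hl : l₁.Relations θ) (hn : 2 ≤ n)
    (hm : 2 ≤ m) (hmin : relVariety θ = minimalCone n m)
    (φ : Λ₁.toeplitz ≃ₐ[ℂ] Λ₂.toeplitz) (hφ : Continuous φ) (l₂ : Λ₂.Labelling n m)
    (g : Fin n ⊕ Fin m) : coeff 1 (φ (Λ₁.toeplitzShift (l₁.edge g))) = 0 := by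
  let Φ : Λ₁.toeplitz →L[ℂ] Λ₂.toeplitz := ⟨φ.toLinearMap, hφ⟩
  let ρ : Λ₁.toeplitz →L[ℂ] ℂ := coeff 1 ∘L Φ
  let D : Fin n ⊕ Fin m → Λ₁.toeplitz →L[ℂ] ℂ := fun h => coeff (l₂.edge h) ∘L Φ
  have hD : ∀ h a b, D h (a * b) = ρ a * D h b + D h a * ρ b := fun h a b => by
    change coeff (l₂.edge h) (φ (a * b)) = _
    rw [map_mul, l₂.coeff_edge_mul]
    rfl
  have hρ1 : ρ 1 = 1 := by
    change coeff 1 (φ 1) = 1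
    rw [map_one, coeff_one_one]
  let X := linearPart l₁ l₂ φ
  have hcomb : ∀ c : Fin n ⊕ Fin m → ℂ, ∀ a b, (∑ h, c h • D h) (a * b) =
      ρ a * (∑ h, c h • D h) b + (∑ h, c h • D h) a * ρ b := fun c a b => by
    simp only [_root_.sum_apply, _root_.smul_apply, hD, smul_eq_mul, Finset.mul_sum,
      Finset.sum_mul, ← Finset.sum_add_distrib]
    exact Finset.sum_congr rfl fun h _ => by ring
  have hX : ∀ c : Fin n ⊕ Fin m → ℂ, ∀ g,
      (∑ h, c h • D h) (Λ₁.toeplitzShift (l₁.edge g)) = (X *ᵥ c) g := fun c g => by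
    simp only [_root_.sum_apply, _root_.smul_apply, smul_eq_mul, Matrix.mulVec, dotProduct]
    exact Finset.sum_congr rfl fun h _ => mul_comm _ _
  -- a combination of the `D h` that vanishes at the edges of `Λ₁` is zero, but the `D h` are
  -- linearly independent, as `φ` is surjective
  have hinj : Function.Injective X.mulVecLin := by
    refine (injective_iff_map_eq_zero _).2 fun c hc => funext fun h => ?_
    have h1 : ∑ h, c h • D h = 0 := l₁.derivation_ext hρ1 (hcomb c) (fun a b => by simp)
      fun g => by
        rw [hX]
        exact congrFun hc g
    have h2 := congrArg (fun F => F (φ.symm (Λ₂.toeplitzShift (l₂.edge h)))) h1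
    have h3 : ∀ k, D k (φ.symm (Λ₂.toeplitzShift (l₂.edge h))) = if h = k then 1 else 0 :=
      fun k => by
        change coeff (l₂.edge k) (φ (φ.symm _)) = _
        rw [AlgEquiv.apply_symm_apply, l₂.coeff_edge]
    simpa [_root_.sum_apply, h3, -Fintype.sum_sum_type] using h2
  have hsurj : Function.Surjective X.mulVecLin := LinearMap.injective_iff_surjective.1 hinj
  -- every function on the edges is the restriction of a derivation, hence satisfies the
  -- linearised relations
  set p : Fin n ⊕ Fin m → ℂ := fun g => ρ (Λ₁.toeplitzShift (l₁.edge g)) with hp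
  have hlin : ∀ (y : Fin n ⊕ Fin m → ℂ) (c : Fin n × Fin m),
      p (.inl c.1) * y (.inr c.2) + y (.inl c.1) * p (.inr c.2) =
        p (.inr (θ c).2) * y (.inl (θ c).1) + y (.inr (θ c).2) * p (.inl (θ c).1) := by
    intro y c
    obtain ⟨d, hd⟩ := hsurj y
    have hd' : ∀ g, (∑ h, d h • D h) (Λ₁.toeplitzShift (l₁.edge g)) = y g := fun g => by
      rw [hX]
      exact congrFun hd g
    have h1 := congrArg (fun x => (∑ h, d h • D h) (Λ₁.toeplitzShift x)) (hl c.1 c.2)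
    simp only [toeplitzShift_mul, hcomb] at h1
    rw [← hd', ← hd', ← hd', ← hd']
    exact h1
  have hn0 : NeZero n := ⟨by omega⟩
  have hm0 : NeZero m := ⟨by omega⟩
  have hne : (0 : Fin n) ≠ ⟨1, by omega⟩ := fun h => by simpa using congrArg Fin.val h
  have hne' : (0 : Fin m) ≠ ⟨1, by omega⟩ := fun h => by simpa using congrArg Fin.val h
  have hz : ∀ i, p (.inl i) = 0 := by
    have h1 : Sum.elim (fun i => p (.inl i)) (Pi.single 0 1) ∈ minimalCone n m := by
      rw [← hmin]
      intro c
      have := hlin (Sum.elim 0 (Pi.single 0 1)) c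
      simp only [Sum.elim_inl, Sum.elim_inr, Pi.zero_apply] at this ⊢
      linear_combination this
    rcases h1 with h1 | h1 | h1
    · simpa using h1 0
    · exact h1
    · have := h1.2 0 ⟨1, by omega⟩
      simp [hne'.symm] at this
  have hw : ∀ j, p (.inr j) = 0 := by
    have h1 : Sum.elim (Pi.single 0 1) (fun j => p (.inr j)) ∈ minimalCone n m := by
      rw [← hmin]
      intro c
      have := hlin (Sum.elim (Pi.single 0 1) 0) c
      simp only [Sum.elim_inl, Sum.elim_inr, Pi.zero_apply] at this ⊢
      linear_combination this
    rcases h1 with h1 | h1 | h1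
    · exact h1
    · simpa using h1 0
    · have := h1.1 0 ⟨1, by omega⟩
      simp [hne.symm] at this
  cases g with
  | inl i => exact hz i
  | inr j => exact hw j

/-- The chain rule at the character `coeff 1`. -/
theorem coeff_edge_apply (φ : Λ₁.toeplitz ≃ₐ[ℂ] Λ₂.toeplitz) (hφ : Continuous φ)
    (h0 : ∀ a, coeff 1 (φ a) = coeff 1 a) (h : Fin n ⊕ Fin m) (a : Λ₁.toeplitz) :
    coeff (l₂.edge h) (φ a) = ∑ g, coeff (l₁.edge g) a * linearPart l₁ l₂ φ g h := by
  let Φ : Λ₁.toeplitz →L[ℂ] Λ₂.toeplitz := ⟨φ.toLinearMap, hφ⟩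
  have h1 : coeff (l₂.edge h) ∘L Φ = ∑ g, linearPart l₁ l₂ φ g h • coeff (l₁.edge g) := by
    refine l₁.derivation_ext (ρ := coeff 1) coeff_one_one (fun a b => ?_) (fun a b => ?_)
      fun g => ?_
    · change coeff (l₂.edge h) (φ (a * b)) = _
      rw [map_mul, l₂.coeff_edge_mul, h0, h0]
      rfl
    · simp only [_root_.sum_apply, _root_.smul_apply, l₁.coeff_edge_mul, smul_eq_mul,
        Finset.mul_sum, Finset.sum_mul, ← Finset.sum_add_distrib]
      exact Finset.sum_congr rfl fun h _ => by ring
    · simp only [_root_.sum_apply, _root_.smul_apply, l₁.coeff_edge, smul_eq_mul, mul_ite, mul_one,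
        mul_zero, Finset.sum_ite_eq, Finset.mem_univ, if_true]
      rfl
  have h2 := congrArg (fun F => F a) h1
  simp only [_root_.sum_apply, _root_.smul_apply, smul_eq_mul] at h2
  refine Eq.trans h2 (Finset.sum_congr rfl fun g _ => mul_comm _ _)

theorem linearPart_symm_mul (φ : Λ₁.toeplitz ≃ₐ[ℂ] Λ₂.toeplitz) (hφ : Continuous φ)
    (h0 : ∀ a, coeff 1 (φ a) = coeff 1 a) :
    linearPart l₂ l₁ φ.symm * linearPart l₁ l₂ φ = 1 := by
  ext h h'
  have h1 := coeff_edge_apply (l₁ := l₁) (l₂ := l₂) φ hφ h0 h'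
    (φ.symm (Λ₂.toeplitzShift (l₂.edge h)))
  rw [AlgEquiv.apply_symm_apply, l₂.coeff_edge] at h1
  rw [Matrix.mul_apply, Matrix.one_apply, h1]
  rfl

/-- The sum of the coefficients of degree two, weighted by a point `p` of the cone
`relVariety θ`, is multiplicative to second order. -/
theorem Labelling.Relations.sum_coeff_degree_two {Λ : TwoGraph.{u}} {l : Λ.Labelling n m}
    {θ : Equiv.Perm (Fin n × Fin m)} (hl : l.Relations θ) {p : Fin n ⊕ Fin m → ℂ}
    (hp : p ∈ relVariety θ) {a b : Λ.toeplitz} (ha : coeff 1 a = 0) (hb : coeff 1 b = 0) :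
    (∑ i, ∑ i', coeff ((l.e i : Λ.Path) * (l.e i' : Λ.Path)) (a * b) * (p (.inl i) * p (.inl i'))) +
      (∑ c : Fin n × Fin m, coeff ((l.e c.1 : Λ.Path) * (l.f c.2 : Λ.Path)) (a * b) *
        (p (.inl c.1) * p (.inr c.2))) +
      (∑ j, ∑ j', coeff ((l.f j : Λ.Path) * (l.f j' : Λ.Path)) (a * b) *
        (p (.inr j) * p (.inr j'))) =
    (∑ g, coeff (l.edge g) a * p g) * ∑ g, coeff (l.edge g) b * p g := by
  simp only [l.coeff_e_mul_e _ _ ha hb, l.coeff_f_mul_f _ _ ha hb, hl.coeff_e_mul_f _ _ ha hb,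
    add_mul, Finset.sum_add_distrib, Fintype.sum_sum_type, mul_add]
  have h1 : ∑ c : Fin n × Fin m, coeff (l.f (θ c).2 : Λ.Path) a *
      coeff (l.e (θ c).1 : Λ.Path) b * (p (.inl c.1) * p (.inr c.2)) =
        ∑ c : Fin n × Fin m, coeff (l.f c.2 : Λ.Path) a * coeff (l.e c.1 : Λ.Path) b *
          (p (.inl c.1) * p (.inr c.2)) :=
    Eq.trans (Finset.sum_congr rfl fun c _ => by rw [hp c])
      (Equiv.sum_comp θ fun c => coeff (l.f c.2 : Λ.Path) a * coeff (l.e c.1 : Λ.Path) b *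
          (p (.inl c.1) * p (.inr c.2)))
  have h2 : ∀ {α β : Type} [Fintype α] [Fintype β] (x y : α → ℂ) (x' y' : β → ℂ),
      ∑ i, ∑ j, x i * x' j * (y i * y' j) = (∑ i, x i * y i) * ∑ j, x' j * y' j := by
    intro α β _ _ x y x' y'
    rw [Finset.sum_mul_sum]
    exact Finset.sum_congr rfl fun i _ => Finset.sum_congr rfl fun j _ => by ring
  rw [h1, Fintype.sum_prod_type, Fintype.sum_prod_type_right]
  dsimp only
  rw [h2, h2, h2]
  have h3 := h2 (fun j => coeff (l.f j : Λ.Path) a) (fun j => p (.inr j))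
    (fun i => coeff (l.e i : Λ.Path) b) (fun i => p (.inl i))
  have h4 : ∑ j, ∑ i, coeff (l.f j : Λ.Path) a * coeff (l.e i : Λ.Path) b *
      (p (.inl i) * p (.inr j)) = (∑ j, coeff (l.f j : Λ.Path) a * p (.inr j)) *
        ∑ i, coeff (l.e i : Λ.Path) b * p (.inl i) := by
    rw [← h3]
    exact Finset.sum_congr rfl fun j _ => Finset.sum_congr rfl fun i _ => by ring
  rw [h4]
  simp only [Labelling.edge, Sum.elim_inl, Sum.elim_inr]
  ring

/-- The linear part of an isomorphism maps the cone of `Λ₂` to the cone of `Λ₁`. -/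
theorem linearPart_mulVec_mem {θ₁ θ₂ : Equiv.Perm (Fin n × Fin m)} (hl₁ : l₁.Relations θ₁)
    (hl₂ : l₂.Relations θ₂) (φ : Λ₁.toeplitz ≃ₐ[ℂ] Λ₂.toeplitz)
    (h0 : ∀ a, coeff 1 (φ a) = coeff 1 a) {p : Fin n ⊕ Fin m → ℂ} (hp : p ∈ relVariety θ₂) :
    linearPart l₁ l₂ φ *ᵥ p ∈ relVariety θ₁ := by
  intro c
  have h1 : ∀ g, coeff 1 (φ (Λ₁.toeplitzShift (l₁.edge g))) = 0 := fun g => by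
    rw [h0, l₁.coeff_one_edge]
  have h2 : φ (Λ₁.toeplitzShift (l₁.edge (.inl c.1))) * φ (Λ₁.toeplitzShift (l₁.edge (.inr c.2))) =
      φ (Λ₁.toeplitzShift (l₁.edge (.inr (θ₁ c).2))) *
        φ (Λ₁.toeplitzShift (l₁.edge (.inl (θ₁ c).1))) := by
    rw [← map_mul, ← map_mul, ← toeplitzShift_mul, ← toeplitzShift_mul]
    exact congrArg (fun x => φ (Λ₁.toeplitzShift x)) (hl₁ c.1 c.2)
  have h3 := hl₂.sum_coeff_degree_two hp (h1 (.inl c.1)) (h1 (.inr c.2))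
  have h4 := hl₂.sum_coeff_degree_two hp (h1 (.inr (θ₁ c).2)) (h1 (.inl (θ₁ c).1))
  rw [h2] at h3
  exact (h3.symm.trans h4).trans (mul_comm _ _)

/-- An isometric isomorphism acts contractively on the coefficients at a family of edges. -/
theorem sum_norm_sq_coeff_le (φ : Λ₁.toeplitz ≃ₐ[ℂ] Λ₂.toeplitz) (hφ : Isometry φ)
    {ι : Type*} [Fintype ι] (g : ι → Λ₁.Path) (hg : Function.Injective g)
    (hd : ∀ i j, Λ₁.d (g i) = Λ₁.d (g j)) (h : ι → Λ₂.Path) (hh : Function.Injective h)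
    (c : ι → ℂ) :
    ∑ k, ‖∑ i, c i * coeff (h k) (φ (Λ₁.toeplitzShift (g i)))‖ ^ 2 ≤ ∑ i, ‖c i‖ ^ 2 := by
  have h1 := norm_sum_smul_toeplitzShift_sq_le g hg hd c
  set a := ∑ i, c i • Λ₁.toeplitzShift (g i) with ha
  have h2 : ‖φ a‖ = ‖a‖ := by
    have := hφ.dist_eq a 0
    rwa [map_zero, dist_zero_right, dist_zero_right] at this
  have h3 : ‖(φ a : Λ₂.Fock →L[ℂ] Λ₂.Fock) (Λ₂.fockBasis 1)‖ ≤ ‖a‖ := by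
    rw [← h2]
    have h4 := (φ a : Λ₂.Fock →L[ℂ] Λ₂.Fock).le_opNorm (Λ₂.fockBasis 1)
    rwa [Λ₂.fockBasis.orthonormal.1, mul_one] at h4
  have h4 := (Λ₂.fockBasis.orthonormal.comp h hh).sum_inner_products_le
    (s := Finset.univ) ((φ a : Λ₂.Fock →L[ℂ] Λ₂.Fock) (Λ₂.fockBasis 1))
  have h5 : ∀ k, ∑ i, c i * coeff (h k) (φ (Λ₁.toeplitzShift (g i))) = coeff (h k) (φ a) :=
    fun k => by
      rw [ha, map_sum, map_sum]
      exact Finset.sum_congr rfl fun i _ => by rw [map_smul, map_smul, smul_eq_mul]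
  simp only [h5]
  refine le_trans (le_trans h4 ?_) h1
  gcongr

/-- Rigidity: an isometric isomorphism of the Toeplitz algebras makes the trace invariants of the
relations agree. -/
theorem traceInvariants_eq_of_isometry {θ₁ θ₂ : Equiv.Perm (Fin n × Fin m)} (hn : 2 ≤ n)
    (hnm : n < m) (hl₁ : l₁.Relations θ₁) (hl₂ : l₂.Relations θ₂)
    (hmin₁ : relVariety θ₁ = minimalCone n m) (hmin₂ : relVariety θ₂ = minimalCone n m)
    (φ : Λ₁.toeplitz ≃ₐ[ℂ] Λ₂.toeplitz) (hφ : Isometry φ) :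
    traceInvariants θ₁ = traceInvariants θ₂ := by
  have hφ' : Isometry φ.symm := hφ.right_inv φ.apply_symm_apply
  have h0 : ∀ a, coeff 1 (φ a) = coeff 1 a := fun a => by
    let Φ : Λ₁.toeplitz →L[ℂ] Λ₂.toeplitz := ⟨φ.toLinearMap, hφ.continuous⟩
    have h1 : coeff 1 ∘L Φ = coeff 1 := l₁.character_ext
      (by change coeff 1 (φ 1) = 1; rw [map_one, coeff_one_one]) coeff_one_one
      (fun a b => by change coeff 1 (φ (a * b)) = _; rw [map_mul, coeff_one_mul]; rfl)
      coeff_one_mul fun g => by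
        rw [l₁.coeff_one_edge]
        exact coeff_one_apply_edge hl₁ hn (by omega) hmin₁ φ hφ.continuous l₂ g
    exact congrArg (fun F => F a) h1
  have h0' : ∀ a, coeff 1 (φ.symm a) = coeff 1 a := fun a => by
    rw [← h0, AlgEquiv.apply_symm_apply]
  set T := linearPart l₁ l₂ φ with hT
  set T' := linearPart l₂ l₁ φ.symm with hT'
  have hTT : T' * T = 1 := linearPart_symm_mul φ hφ.continuous h0
  obtain ⟨hlr, hrl, ⟨α, hα⟩, β, hβ⟩ := blockDiagonal_of_minimalCone hn hnm hTT fun p hp => by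
    rw [← hmin₁]
    exact linearPart_mulVec_mem hl₁ hl₂ φ h0 (by rwa [hmin₂])
  have hTT2 : T * T' = 1 := mul_eq_one_comm.1 hTT
  have hn0 : NeZero n := ⟨by omega⟩
  have hm0 : NeZero m := ⟨by omega⟩
  have hA : T.toBlocks₁₁ * T'.toBlocks₁₁ = 1 := by
    ext i k
    have := congrFun (congrFun hTT2 (.inl i)) (.inl k)
    simpa [Matrix.mul_apply, hlr, Matrix.one_apply, Matrix.toBlocks₁₁] using this
  have hB : T.toBlocks₂₂ * T'.toBlocks₂₂ = 1 := by
    ext i k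
    have := congrFun (congrFun hTT2 (.inr i)) (.inr k)
    simpa [Matrix.mul_apply, hrl, Matrix.one_apply, Matrix.toBlocks₂₂] using this
  have hAu := mul_conjTranspose_eq_one_of_contractive hA
    (sum_norm_sq_coeff_le φ hφ (fun i => (l₁.e i : Λ₁.Path)) (fun i j h => l₁.e_inj.1 h)
      (fun i j => by rw [l₁.d_e, l₁.d_e]) (fun i => (l₂.e i : Λ₂.Path)) fun i j h => l₂.e_inj.1 h)
    (sum_norm_sq_coeff_le φ.symm hφ' (fun i => (l₂.e i : Λ₂.Path)) (fun i j h => l₂.e_inj.1 h)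
      (fun i j => by rw [l₂.d_e, l₂.d_e]) (fun i => (l₁.e i : Λ₁.Path)) fun i j h => l₁.e_inj.1 h)
  have hBu := mul_conjTranspose_eq_one_of_contractive hB
    (sum_norm_sq_coeff_le φ hφ (fun i => (l₁.f i : Λ₁.Path)) (fun i j h => l₁.f_inj.1 h)
      (fun i j => by rw [l₁.d_f, l₁.d_f]) (fun i => (l₂.f i : Λ₂.Path)) fun i j h => l₂.f_inj.1 h)
    (sum_norm_sq_coeff_le φ.symm hφ' (fun i => (l₂.f i : Λ₂.Path)) (fun i j h => l₂.f_inj.1 h)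
      (fun i j => by rw [l₂.d_f, l₂.d_f]) (fun i => (l₁.f i : Λ₁.Path)) fun i j h => l₁.f_inj.1 h)
  refine traceInvariants_eq_of_intertwining hA hB (commute_ones_of_rowSums hAu hα)
    (commute_ones_of_rowSums hBu hβ) fun x y => ?_
  -- compare the coefficients at `e_k f_l`, where `y = (k, l)`
  have h1 : ∀ g, coeff 1 (φ (Λ₁.toeplitzShift (l₁.edge g))) = 0 := fun g => by
    rw [h0, l₁.coeff_one_edge]
  have h2 : φ (Λ₁.toeplitzShift (l₁.edge (.inl x.1))) * φ (Λ₁.toeplitzShift (l₁.edge (.inr x.2))) =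
      φ (Λ₁.toeplitzShift (l₁.edge (.inr (θ₁ x).2))) *
        φ (Λ₁.toeplitzShift (l₁.edge (.inl (θ₁ x).1))) := by
    rw [← map_mul, ← map_mul, ← toeplitzShift_mul, ← toeplitzShift_mul]
    exact congrArg (fun z => φ (Λ₁.toeplitzShift z)) (hl₁ x.1 x.2)
  have h3 := hl₂.coeff_e_mul_f y.1 y.2 (h1 (.inl x.1)) (h1 (.inr x.2))
  have h4 := hl₂.coeff_e_mul_f y.1 y.2 (h1 (.inr (θ₁ x).2)) (h1 (.inl (θ₁ x).1))
  rw [h2, h4] at h3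
  have h5 : T (.inr (θ₁ x).2) (.inl y.1) * T (.inl (θ₁ x).1) (.inr y.2) +
      T (.inr (θ₁ x).2) (.inr (θ₂ y).2) * T (.inl (θ₁ x).1) (.inl (θ₂ y).1) =
      T (.inl x.1) (.inl y.1) * T (.inr x.2) (.inr y.2) +
        T (.inl x.1) (.inr (θ₂ y).2) * T (.inr x.2) (.inl (θ₂ y).1) := h3
  rw [hrl, hlr, hlr, hrl] at h5
  simp only [Matrix.toBlocks₁₁, Matrix.toBlocks₂₂, Matrix.of_apply]
  linear_combination h5

end Rigidity

theorem iso_of_toeplitzIsometric {Λ₁ Λ₂ : TwoGraph.{u}} (h₁ : Λ₁.HasMinimalGelfandSpace 2 3)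
    (h₂ : Λ₂.HasMinimalGelfandSpace 2 3) (h : ToeplitzIsometric Λ₁ Λ₂) : Iso Λ₁ Λ₂ := by
  obtain ⟨l₁, h₁⟩ := h₁
  obtain ⟨l₂, h₂⟩ := h₂
  obtain ⟨φ, hφ⟩ := h
  obtain ⟨θ₁, hθ₁⟩ := l₁.exists_relations
  obtain ⟨θ₂, hθ₂⟩ := l₂.exists_relations
  have hc : ProdConj θ₁ θ₂ := prodConj_of_traceInvariants_eq
    (traceInvariants_eq_of_isometry le_rfl (by norm_num) hθ₁ hθ₂
      (hθ₁.relVariety_eq_minimalCone h₁) (hθ₂.relVariety_eq_minimalCone h₂) φ hφ)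
  exact (HasRelations.of_prodConj ⟨l₁, hθ₁⟩ hc).iso ⟨l₂, hθ₂⟩

theorem IsCyclicType.hasMinimalGelfandSpace {Λ : TwoGraph.{u}} {n m : ℕ}
    (h : Λ.IsCyclicType n m) : Λ.HasMinimalGelfandSpace n m := by
  obtain ⟨θ, hc, hs, l, hl⟩ := h
  exact ⟨l, Labelling.Relations.range_gelfandCoord_eq_minimal hl
    (relVariety_eq_minimalCone_of_isCycle hc hs)⟩

/-- The 2-graph of `theta k`. -/
def thetaGraph (k : Fin 14) : CyclicTwoGraph.{u} 2 3 :=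
  ⟨ofPerm (theta k), theta k, theta_isCycle k, theta_support k, ofPerm_hasRelations _⟩

theorem mk_thetaGraph_eq_iff (k : Fin 14) (Λ : CyclicTwoGraph.{u} 2 3) :
    (⟦thetaGraph k⟧ : Quotient (cyclicSetoid.{u} 2 3)) = ⟦Λ⟧ ↔ Λ.1.HasRelations (theta k) := by
  rw [Quotient.eq]
  exact ⟨fun h => (ofPerm_hasRelations (theta k)).of_iso h,
    fun h => (ofPerm_hasRelations (theta k)).iso h⟩

theorem bijective_mk_thetaGraph : Function.Bijective fun k : Fin 14 =>
    (⟦thetaGraph k⟧ : Quotient (cyclicSetoid.{u} 2 3)) := by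
  constructor
  · intro k k' h
    have h1 := (mk_thetaGraph_eq_iff.{u} k (thetaGraph k')).1 h
    exact eq_of_prodConj_theta k k' (h1.prodConj (ofPerm_hasRelations (theta k')))
  · intro q
    induction q using Quotient.inductionOn with
    | h Λ =>
      obtain ⟨θ, hc, hs, h⟩ := Λ.2
      obtain ⟨k, hk⟩ := exists_prodConj_theta hc hs
      exact ⟨k, (mk_thetaGraph_eq_iff k Λ).2 (h.of_prodConj hk.symm)⟩

end TwoGraph

theorem theorem7p5 :
    -- isometric isomorphism of the algebras versus isomorphism of the 2-graphs, cyclic relations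
    (∀ Λ₁ Λ₂ : TwoGraph.{u}, Λ₁.IsCyclicType 2 3 → Λ₂.IsCyclicType 2 3 →
      (TwoGraph.ToeplitzIsometric Λ₁ Λ₂ ↔ TwoGraph.Iso Λ₁ Λ₂)) ∧
    -- cyclic relations give a Gelfand space of minimal type
    (∀ Λ : TwoGraph.{u}, Λ.IsCyclicType 2 3 → Λ.HasMinimalGelfandSpace 2 3) ∧
    -- the classification under the assumption on the Gelfand spaces
    (∀ Λ₁ Λ₂ : TwoGraph.{u}, Λ₁.HasMinimalGelfandSpace 2 3 → Λ₂.HasMinimalGelfandSpace 2 3 →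
      (TwoGraph.ToeplitzIsometric Λ₁ Λ₂ ↔ TwoGraph.Iso Λ₁ Λ₂)) ∧
    -- the isomorphism classes correspond to the 14 permutations
    (∃ c : Fin 14 ≃ Quotient (TwoGraph.cyclicSetoid.{u} 2 3),
      ∀ (k : Fin 14) (Λ : TwoGraph.CyclicTwoGraph.{u} 2 3),
        c k = ⟦Λ⟧ ↔ Λ.1.HasRelations (TwoGraph.theta k)) := by
  have key : ∀ Λ₁ Λ₂ : TwoGraph.{u}, Λ₁.HasMinimalGelfandSpace 2 3 →
      Λ₂.HasMinimalGelfandSpace 2 3 →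
        (TwoGraph.ToeplitzIsometric Λ₁ Λ₂ ↔ TwoGraph.Iso Λ₁ Λ₂) := fun _ _ h₁ h₂ =>
    ⟨TwoGraph.iso_of_toeplitzIsometric h₁ h₂, TwoGraph.Iso.toeplitzIsometric⟩
  exact ⟨fun Λ₁ Λ₂ h₁ h₂ => key Λ₁ Λ₂ h₁.hasMinimalGelfandSpace h₂.hasMinimalGelfandSpace,
    fun Λ h => h.hasMinimalGelfandSpace, key,
    Equiv.ofBijective _ TwoGraph.bijective_mk_thetaGraph, TwoGraph.mk_thetaGraph_eq_iff⟩
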